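/- Let $(R,\mathfrak m)$ be a Noetherian local ring with $\dim R>0$ and infinite residue field $R/\mathfrak m$, let $I$ be a proper ideal of $R$, let $M$ be a finitely generated $R$-module, and let $d$ be a positive integer with $\dim_R M\le d$. For a finitely generated $R$-module $N$ with $\dim_R N\le d$, the j-multiplicity of $I$ with respect to $N$ is \[ j_d(I,N)=\lim_{n\to\infty}\frac{(d-1)!}{n^{d-1}}\,\lambda_R\bigl(H^0_{\mathfrak m}(I^nN/I^{n+1}N)\bigr), \] where $\lambda$ denotes length and $H^0_{\mathfrak m}(\cdot)$ is the submodule of elements annihilated by some power of $\mathfrak m$. Let $\operatorname{Assh}_R M$ be the (finite) set of associated primes $\mathfrak p$ of $M$ with $\dim R/\mathfrak p=\dim_R M$. Then the limits defining $j_d(I,M)$ and $j_d(I,R/\mathfrak p)$, for $\mathfrak p\in\operatorname{Assh}_R M$, exist, and \[ j_d(I,M)=\sum_{\mathfrak p\in\operatorname{Assh}_R M}\lambda_{R_{\mathfrak p}}(M_{\mathfrak p})\cdot j_d(I,R/\mathfrak p). \] -/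

import Mathlib

open Filter Topology

noncomputable section

namespace JMult

universe u v

/-- The `n`-th homogeneous component `I ^ n M / I ^ (n + 1) M` of the associated graded module
of `M` with respect to the ideal `I`. -/
abbrev GrPiece {R : Type u} [CommRing R] (I : Ideal R) (M : Type v) [AddCommGroup M] [Module R M]
    (n : ℕ) : Type v :=
  ↥(I ^ n • (⊤ : Submodule R M)) ⧸
    (I ^ (n + 1) • (⊤ : Submodule R M)).submoduleOf (I ^ n • (⊤ : Submodule R M))

/-- The length of `H⁰_𝔪(I ^ n M / I ^ (n + 1) M)`, where `𝔪` is the maximal ideal of `R` and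
`H⁰_𝔪(N)` is the submodule of all elements of `N` killed by some power of `𝔪`. For a finitely
generated module over a Noetherian local ring this length is finite, so `toNat` is harmless. -/
def grLength {R : Type u} [CommRing R] [IsLocalRing R] (I : Ideal R)
    (M : Type v) [AddCommGroup M] [Module R M] (n : ℕ) : ℕ :=
  (Module.length R
    ((IsLocalRing.maximalIdeal R).primaryComponent (GrPiece I M n))).toNat

/-- The normalized lengths `(d - 1)! / n ^ (d - 1) * λ(H⁰_𝔪(I ^ n M / I ^ (n + 1) M))`
(used for `d ≥ 1`). -/
def jSeq {R : Type u} [CommRing R] [IsLocalRing R] (d : ℕ) (I : Ideal R)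
    (M : Type v) [AddCommGroup M] [Module R M] (n : ℕ) : ℝ :=
  ((d - 1).factorial : ℝ) / (n : ℝ) ^ (d - 1) * (grLength I M n : ℝ)

/-- The j-multiplicity `j_d(I, M)`, the limit of the normalized lengths. -/
def jMult {R : Type u} [CommRing R] [IsLocalRing R] (d : ℕ) (I : Ideal R)
    (M : Type v) [AddCommGroup M] [Module R M] : ℝ :=
  limUnder atTop (jSeq d I M)

/-- `Assh_R M`: the associated primes `p` of `M` with `dim R / p = dim M`. -/
def assh (R : Type u) [CommRing R] (M : Type v) [AddCommGroup M] [Module R M] :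
    Set (PrimeSpectrum R) :=
  {p | p.asIdeal ∈ associatedPrimes R M ∧
    ringKrullDim (R ⧸ p.asIdeal) = Module.supportDim R M}

theorem assh_finite (R : Type u) [CommRing R] [IsNoetherianRing R]
    (M : Type v) [AddCommGroup M] [Module R M] [Module.Finite R M] : (assh R M).Finite := by
  refine Set.Finite.of_finite_image ((associatedPrimes.finite R M).subset ?_)
    (f := PrimeSpectrum.asIdeal) (fun p _ q _ h => PrimeSpectrum.ext h)
  rintro _ ⟨p, hp, rfl⟩
  exact hp.1

/-- The length of `M_p` over `R_p`; it is finite when `p` is minimal in the support of a finitely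
generated module `M` over a Noetherian ring, in particular for `p` in `Assh_R M`. -/
def localLength {R : Type u} [CommRing R] (M : Type v) [AddCommGroup M] [Module R M]
    (p : PrimeSpectrum R) : ℕ :=
  (Module.length (Localization.AtPrime p.asIdeal)
    (LocalizedModule p.asIdeal.primeCompl M)).toNat

end JMult

end

/-! Torsion does not behave well in exact sequences, so `H⁰_𝔪` is replaced by a quantity that does.
With `G = ⨁ I ^ n M / I ^ (n + 1) M`, consider for each `i` the growth in degree `k = d - 1` of the
finite-length pieces of `G / 𝔪 ^ i G`, and let `grMult` be the supremum over `i`. It takes values in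
`[0, ∞]`.

Growth rates exist as limits: a filter-regular element of degree one in the Rees algebra, available
because the residue field is infinite, expresses length differences as lengths of a smaller
quotient, and a Stolz–Cesàro argument gives induction on `k` (`exists_tendsto_rlen`). Artin–Rees
over the Rees algebra makes the supremum additive in chains of graded submodules (`mult_add`). If
some `y ∈ 𝔪` is regular on a graded quotient of finite multiplicity, additivity forces that
multiplicity to vanish (`mult_eq_zero_of_regular`). Dividing out torsion therefore loses nothing: a
finite `grMult` is the growth of `H⁰_𝔪(G)`, that is, the j-multiplicity up to normalization
(`exists_torsion`, `tendsto_jSeq`).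

It remains to treat `grMult` as a multiplicity. It is additive on short exact sequences
(`grMult_add_of_exact`), finite in dimension at most `k + 1` (`grMult_ne_top`) and zero in dimension
at most `k` (`grMult_eq_zero`). Prime filtrations then reduce the formula to `M = R ⧸ q`, where a
single localized length is `1` (`grMult_eq_sum`). -/

noncomputable section

namespace JMult

open scoped ENNReal

universe u v w x

/-! ### Relative lengths of submodules -/

section RelLength

variable {R : Type u} [CommRing R] {M : Type v} [AddCommGroup M] [Module R M]
  {N : Type w} [AddCommGroup N] [Module R N]

theorem mem_submoduleOf {A B : Submodule R M} {a : A} :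
    a ∈ B.submoduleOf A ↔ (a : M) ∈ B := Iff.rfl

/-- The length of `A / (A ∩ B)`, as an extended nonnegative real number. -/
def rlen (A B : Submodule R M) : ℝ≥0∞ := (Module.length R (A ⧸ B.submoduleOf A) : ℕ∞)

theorem rlen_eq_of_surjective {A B : Submodule R M} (f : A →ₗ[R] N)
    (hf : Function.Surjective f) (hk : ∀ a : A, f a = 0 ↔ (a : M) ∈ B) :
    rlen A B = (Module.length R N : ℕ∞) := by
  have h : B.submoduleOf A = LinearMap.ker f := by
    ext a
    rw [LinearMap.mem_ker, hk]
    exact mem_submoduleOf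
  rw [rlen, h, (f.quotKerEquivOfSurjective hf).length_eq]

theorem rlen_eq_zero_of_le {A B : Submodule R M} (h : A ≤ B) : rlen A B = 0 := by
  have : Subsingleton (A ⧸ B.submoduleOf A) := by
    rw [Submodule.Quotient.subsingleton_iff, Submodule.submoduleOf_eq_top]
    exact h
  simp [rlen]

theorem rlen_map (f : M →ₗ[R] N) (A : Submodule R M) (C : Submodule R N) :
    rlen (A.map f) C = rlen A (C.comap f) := by
  let g : A →ₗ[R] A.map f := f.submoduleMap A
  have hg : Function.Surjective g := f.submoduleMap_surjective A
  symm
  refine rlen_eq_of_surjective ((C.submoduleOf (A.map f)).mkQ ∘ₗ g)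
    ((Submodule.mkQ_surjective _).comp hg) fun a => ?_
  simp [g, mem_submoduleOf, LinearMap.submoduleMap]

theorem rlen_inf (A B : Submodule R M) : rlen A (A ⊓ B) = rlen A B := by
  unfold rlen
  congr 3
  all_goals
    ext a
    simp [mem_submoduleOf]

theorem rlen_sup (A B : Submodule R M) : rlen (A ⊔ B) B = rlen A B := by
  have h1 := rlen_map B.mkQ (A ⊔ B) ⊥
  have h2 := rlen_map B.mkQ A ⊥
  have h : (A ⊔ B).map B.mkQ = A.map B.mkQ := by simp [Submodule.map_sup]
  rw [h] at h1
  simp only [Submodule.comap_bot, Submodule.ker_mkQ] at h1 h2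
  rw [← h1, ← h2]

theorem rlen_add {A B C : Submodule R M} (hCB : C ≤ B) (hBA : B ≤ A) :
    rlen A C = rlen A B + rlen B C := by
  let f : (B ⧸ C.submoduleOf B) →ₗ[R] (A ⧸ C.submoduleOf A) :=
    Submodule.mapQ _ _ (Submodule.inclusion hBA) fun b hb => by
      simpa [mem_submoduleOf] using hb
  let g : (A ⧸ C.submoduleOf A) →ₗ[R] (A ⧸ B.submoduleOf A) :=
    Submodule.mapQ _ _ LinearMap.id fun b hb => by
      simp only [mem_submoduleOf, Submodule.mem_comap, LinearMap.id_apply] at hb ⊢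
      exact hCB hb
  have hf : Function.Injective f := by
    rw [injective_iff_map_eq_zero]
    intro x hx
    obtain ⟨x, rfl⟩ := Submodule.Quotient.mk_surjective _ x
    simp only [f, Submodule.mapQ_apply, Submodule.Quotient.mk_eq_zero,
      mem_submoduleOf] at hx ⊢
    exact hx
  have hg : Function.Surjective g := by
    intro x
    obtain ⟨x, rfl⟩ := Submodule.Quotient.mk_surjective _ x
    exact ⟨Submodule.Quotient.mk x, rfl⟩
  have he : Function.Exact f g := by
    intro x
    obtain ⟨x, rfl⟩ := Submodule.Quotient.mk_surjective _ x
    simp only [g, Submodule.mapQ_apply, LinearMap.id_apply, Submodule.Quotient.mk_eq_zero,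
      mem_submoduleOf, Set.mem_range]
    constructor
    · intro hx
      exact ⟨Submodule.Quotient.mk ⟨x, hx⟩, rfl⟩
    · rintro ⟨y, hy⟩
      obtain ⟨y, rfl⟩ := Submodule.Quotient.mk_surjective _ y
      simp only [f, Submodule.mapQ_apply] at hy
      rw [Submodule.Quotient.eq] at hy
      have h2 := hCB (mem_submoduleOf.1 hy)
      have h3 := B.sub_mem y.2 h2
      simpa using h3
  rw [rlen, Module.length_eq_add_of_exact f g hf hg he, rlen, rlen, add_comm]
  simp

theorem rlen_mono_left {A A' : Submodule R M} (h : A ≤ A') (B : Submodule R M) :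
    rlen A B ≤ rlen A' B := by
  rw [← rlen_sup A B, ← rlen_sup A' B,
    rlen_add (A := A' ⊔ B) (B := A ⊔ B) le_sup_right (sup_le_sup_right h B)]
  exact le_add_self

theorem rlen_anti_right (A : Submodule R M) {B B' : Submodule R M} (h : B ≤ B') :
    rlen A B' ≤ rlen A B := by
  rw [← rlen_inf A B, ← rlen_inf A B',
    rlen_add (inf_le_inf_left A h) inf_le_left]
  exact le_self_add

theorem rlen_ne_top_of_isFiniteLength {A B : Submodule R M}
    (h : IsFiniteLength R (A ⧸ B.submoduleOf A)) : rlen A B ≠ ⊤ := by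
  have := Module.length_ne_top_iff.2 h
  simpa [rlen] using this

end RelLength

/-! ### Binomial weights and a Stolz–Cesàro argument -/

section Growth

/-- The binomial weight `(n + k).choose k`. -/
def weight (k n : ℕ) : ℝ≥0∞ := ((n + k).choose k : ℕ)

theorem weight_ne_top (k n : ℕ) : weight k n ≠ ⊤ := ENNReal.natCast_ne_top _

theorem weight_ne_zero (k n : ℕ) : weight k n ≠ 0 := by
  have : 0 < (n + k).choose k := Nat.choose_pos (by omega)
  simp only [weight, ne_eq, Nat.cast_eq_zero]
  omega

theorem weight_zero (n : ℕ) : weight 0 n = 1 := by simp [weight]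

/-- Pascal's rule: the weights of degree `k` are exactly the differences of those of degree `k + 1`,
so summation produces no error terms. -/
theorem weight_succ (k n : ℕ) : weight (k + 1) (n + 1) = weight (k + 1) n + weight k (n + 1) := by
  unfold weight
  have : (n + 1 + (k + 1)).choose (k + 1) = (n + (k + 1)).choose (k + 1) + (n + 1 + k).choose k := by
    rw [show n + 1 + (k + 1) = (n + 1 + k) + 1 by ring, Nat.choose_succ_succ, add_comm,
      show n + 1 + k = n + (k + 1) by ring]
  rw [this]
  push_cast
  ring

theorem le_of_step_le {f g : ℕ → ℝ≥0∞} {k n₀ : ℕ} {c : ℝ≥0∞}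
    (hf : ∀ n ≥ n₀, f (n + 1) ≤ f n + g (n + 1)) (hg : ∀ n ≥ n₀, g n ≤ c * weight k n) :
    ∀ n ≥ n₀, f n ≤ f n₀ + c * weight (k + 1) n := by
  intro n hn
  induction n, hn using Nat.le_induction with
  | base => exact le_self_add
  | succ n hn ih =>
    calc f (n + 1) ≤ f n + g (n + 1) := hf n hn
      _ ≤ (f n₀ + c * weight (k + 1) n) + c * weight k (n + 1) :=
        add_le_add ih (hg _ (by omega))
      _ = _ := by rw [weight_succ]; ring

theorem le_of_le_step {f g : ℕ → ℝ≥0∞} {k n₀ : ℕ} {c : ℝ≥0∞}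
    (hf : ∀ n ≥ n₀, f n + g (n + 1) ≤ f (n + 1)) (hg : ∀ n ≥ n₀, c * weight k n ≤ g n) :
    ∀ n ≥ n₀, c * weight (k + 1) n ≤ f n + c * weight (k + 1) n₀ := by
  intro n hn
  induction n, hn using Nat.le_induction with
  | base => exact le_add_self
  | succ n hn ih =>
    calc c * weight (k + 1) (n + 1) = c * weight (k + 1) n + c * weight k (n + 1) := by
          rw [weight_succ]; ring
      _ ≤ (f n + c * weight (k + 1) n₀) + g (n + 1) := add_le_add ih (hg _ (by omega))
      _ = (f n + g (n + 1)) + c * weight (k + 1) n₀ := by ring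
      _ ≤ _ := by gcongr; exact hf n hn

theorem weight_ratio (k n : ℕ) :
    weight k n / weight (k + 1) n = ((k + 1 : ℕ) : ℝ≥0∞) / ((n + k + 1 : ℕ) : ℝ≥0∞) := by
  rw [ENNReal.div_eq_div_iff (by simp) (by simp) (weight_ne_zero _ _) (weight_ne_top _ _)]
  unfold weight
  norm_cast
  have := Nat.add_one_mul_choose_eq (n + k) k
  rw [show n + (k + 1) = n + k + 1 by ring]
  linarith

theorem tendsto_weight_ratio (k : ℕ) :
    Tendsto (fun n => weight k n / weight (k + 1) n) atTop (𝓝 0) := by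
  simp_rw [weight_ratio, div_eq_mul_inv]
  have h : Tendsto (fun n : ℕ => (((n + k + 1 : ℕ) : ℝ≥0∞))⁻¹) atTop (𝓝 0) :=
    ENNReal.tendsto_inv_nat_nhds_zero.comp
      (tendsto_atTop_mono (fun n => by simp only [id]; omega) tendsto_id)
  simpa using ENNReal.Tendsto.const_mul h (a := ((k + 1 : ℕ) : ℝ≥0∞)) (Or.inr (by simp))

theorem one_le_weight (k n : ℕ) : 1 ≤ weight k n := by
  have : 0 < (n + k).choose k := Nat.choose_pos (by omega)
  unfold weight
  exact_mod_cast this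

theorem tendsto_const_div_weight (k : ℕ) {c : ℝ≥0∞} (hc : c ≠ ⊤) :
    Tendsto (fun n => c / weight (k + 1) n) atTop (𝓝 0) := by
  have h : Tendsto (fun n => c * (weight k n / weight (k + 1) n)) atTop (𝓝 0) := by
    simpa using ENNReal.Tendsto.const_mul (tendsto_weight_ratio k) (Or.inr hc)
  refine tendsto_of_tendsto_of_tendsto_of_le_of_le tendsto_const_nhds h (fun _ => zero_le) ?_
  intro n
  simp only [div_eq_mul_inv]
  gcongr
  exact le_mul_of_one_le_left zero_le (one_le_weight k n)

theorem weight_shift (k n : ℕ) :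
    weight k (n + 1) / weight k n = 1 + (k : ℝ≥0∞) / ((n + 1 : ℕ) : ℝ≥0∞) := by
  have h0 : ((n + 1 : ℕ) : ℝ≥0∞) ≠ 0 := by simp
  have h1 : (1 : ℝ≥0∞) + (k : ℝ≥0∞) / ((n + 1 : ℕ) : ℝ≥0∞) =
      ((n + 1 + k : ℕ) : ℝ≥0∞) / ((n + 1 : ℕ) : ℝ≥0∞) := by
    rw [Nat.cast_add (n + 1) k, ENNReal.add_div, ENNReal.div_self h0 (by simp)]
  rw [h1, ENNReal.div_eq_div_iff h0 (by simp) (weight_ne_zero _ _) (weight_ne_top _ _)]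
  unfold weight
  norm_cast
  have := Nat.choose_mul_succ_eq (n + k) k
  rw [show n + k + 1 - k = n + 1 by omega] at this
  rw [show n + 1 + k = n + k + 1 by ring]
  linarith

theorem tendsto_weight_shift (k : ℕ) :
    Tendsto (fun n => weight k (n + 1) / weight k n) atTop (𝓝 1) := by
  simp_rw [weight_shift, div_eq_mul_inv]
  have h : Tendsto (fun n : ℕ => (((n + 1 : ℕ) : ℝ≥0∞))⁻¹) atTop (𝓝 0) :=
    ENNReal.tendsto_inv_nat_nhds_zero.comp (tendsto_add_atTop_nat 1)
  simpa using tendsto_const_nhds.add (ENNReal.Tendsto.const_mul h (a := (k : ℝ≥0∞)) (Or.inr (by simp)))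

/-- The one-sided form is needed for the finiteness theorem, where the difference relation is only
an inequality. Finiteness of `f` makes the starting value `f m` negligible against the weight. -/
theorem limsup_div_weight_le {f g : ℕ → ℝ≥0∞} {k n₀ : ℕ} {L : ℝ≥0∞}
    (hfin : ∀ n ≥ n₀, f n ≠ ⊤)
    (hf : ∀ n ≥ n₀, f (n + 1) ≤ f n + g (n + 1))
    (hg : limsup (fun n => g n / weight k n) atTop ≤ L) :
    limsup (fun n => f n / weight (k + 1) n) atTop ≤ L := by
  refine le_of_forall_gt_imp_ge_of_dense fun c hc => ?_
  rcases eq_or_ne c ⊤ with rfl | hc'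
  · exact le_top
  have h1 := eventually_lt_of_limsup_lt (lt_of_le_of_lt hg hc)
  obtain ⟨n₁, hn₁⟩ := eventually_atTop.1 h1
  set m := max n₀ n₁
  have h2 := le_of_step_le (f := f) (g := g) (k := k) (n₀ := m) (c := c)
    (fun n hn => hf n (le_trans (le_max_left _ _) hn)) (fun n hn => by
      have := (hn₁ n (le_trans (le_max_right _ _) hn)).le
      rwa [ENNReal.div_le_iff (weight_ne_zero _ _) (weight_ne_top _ _)] at this)
  have h3 : Tendsto (fun n => f m / weight (k + 1) n + c) atTop (𝓝 c) := by
    simpa using (tendsto_const_div_weight k (hfin m (le_max_left _ _))).add_const c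
  rw [← h3.limsup_eq]
  refine limsup_le_limsup ?_
  filter_upwards [eventually_ge_atTop m] with n hn
  rw [ENNReal.div_le_iff (weight_ne_zero _ _) (weight_ne_top _ _), add_mul,
    ENNReal.div_mul_cancel (weight_ne_zero _ _) (weight_ne_top _ _)]
  exact h2 n hn

theorem le_liminf_div_weight {f g : ℕ → ℝ≥0∞} {k n₀ : ℕ} {L : ℝ≥0∞}
    (hf : ∀ n ≥ n₀, f n + g (n + 1) ≤ f (n + 1))
    (hg : L ≤ liminf (fun n => g n / weight k n) atTop) :
    L ≤ liminf (fun n => f n / weight (k + 1) n) atTop := by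
  refine le_of_forall_lt_imp_le_of_dense fun c hc => ?_
  have hc' : c ≠ ⊤ := hc.ne_top
  have h1 := eventually_lt_of_lt_liminf (lt_of_lt_of_le hc hg)
  obtain ⟨n₁, hn₁⟩ := eventually_atTop.1 h1
  set m := max n₀ n₁
  have h2 := le_of_le_step (f := f) (g := g) (k := k) (n₀ := m) (c := c)
    (fun n hn => hf n (le_trans (le_max_left _ _) hn)) (fun n hn => by
      have := (hn₁ n (le_trans (le_max_right _ _) hn)).le
      rwa [ENNReal.le_div_iff_mul_le (Or.inl (weight_ne_zero _ _))
        (Or.inl (weight_ne_top _ _))] at this)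
  have h3 : Tendsto (fun n => c - c * weight (k + 1) m / weight (k + 1) n) atTop (𝓝 c) := by
    have := tendsto_const_div_weight k (ENNReal.mul_ne_top hc' (weight_ne_top (k + 1) m))
    simpa using ENNReal.Tendsto.sub (tendsto_const_nhds (x := c)) this (Or.inl hc')
  rw [← h3.liminf_eq]
  refine liminf_le_liminf ?_
  filter_upwards [eventually_ge_atTop m] with n hn
  rw [tsub_le_iff_right, ← ENNReal.add_div,
    ENNReal.le_div_iff_mul_le (Or.inl (weight_ne_zero _ _)) (Or.inl (weight_ne_top _ _))]
  exact h2 n hn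

/-- A Stolz–Cesàro lemma for binomial weights. -/
theorem exists_tendsto_div_weight_succ {f g : ℕ → ℝ≥0∞} {k n₀ : ℕ} {L : ℝ≥0∞}
    (hf : ∀ n ≥ n₀, f (n + 1) = f n + g (n + 1))
    (hg : Tendsto (fun n => g n / weight k n) atTop (𝓝 L)) :
    ∃ L', Tendsto (fun n => f n / weight (k + 1) n) atTop (𝓝 L') := by
  by_cases h : ∃ n₁ ≥ n₀, f n₁ = ⊤
  · obtain ⟨n₁, hn₁, h1⟩ := h
    have h2 : ∀ n ≥ n₁, f n = ⊤ := by
      intro n hn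
      induction n, hn using Nat.le_induction with
      | base => exact h1
      | succ n hn ih => rw [hf n (by omega), ih, top_add]
    refine ⟨⊤, tendsto_const_nhds.congr' ?_⟩
    filter_upwards [eventually_ge_atTop n₁] with n hn
    rw [h2 n hn, ENNReal.top_div_of_ne_top (weight_ne_top _ _)]
  · push Not at h
    exact ⟨L, tendsto_of_le_liminf_of_limsup_le
      (le_liminf_div_weight (fun n hn => (hf n hn).ge) hg.liminf_eq.ge)
      (limsup_div_weight_le h (fun n hn => (hf n hn).le) hg.limsup_eq.le)⟩

theorem tendsto_div_weight_shift {f : ℕ → ℝ≥0∞} {k : ℕ} {L : ℝ≥0∞}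
    (hf : Tendsto (fun n => f n / weight k n) atTop (𝓝 L)) :
    Tendsto (fun n => f (n + 1) / weight k n) atTop (𝓝 L) := by
  have h1 := hf.comp (tendsto_add_atTop_nat 1)
  have h2 := ENNReal.Tendsto.mul h1 (Or.inr (by simp)) (tendsto_weight_shift k) (Or.inl (by simp))
  rw [mul_one] at h2
  refine h2.congr fun n => ?_
  simp only [Function.comp, div_eq_mul_inv]
  calc f (n + 1) * (weight k (n + 1))⁻¹ * (weight k (n + 1) * (weight k n)⁻¹)
      = f (n + 1) * ((weight k (n + 1))⁻¹ * weight k (n + 1)) * (weight k n)⁻¹ := by ring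
    _ = _ := by rw [ENNReal.inv_mul_cancel (weight_ne_zero _ _) (weight_ne_top _ _), mul_one]

end Growth

/-! ### Graded submodules of the Rees module -/

section Rees

open PolynomialModule

variable {R : Type u} [CommRing R] {M : Type v} [AddCommGroup M] [Module R M] {I : Ideal R}

/-- Sequences of submodules of `M` that are the homogeneous components of a graded submodule of the
Rees module `⨁ I ^ n M`. -/
structure IsRees (I : Ideal R) (A : ℕ → Submodule R M) : Prop where
  smul_le : ∀ n, I • A n ≤ A (n + 1)
  le_pow : ∀ n, A n ≤ I ^ n • ⊤

namespace IsRees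

variable {A B : ℕ → Submodule R M}

theorem pow_smul_le (hA : IsRees I A) (j n : ℕ) : I ^ j • A n ≤ A (j + n) := by
  induction j with
  | zero => simp
  | succ j ih =>
    rw [pow_succ', mul_smul, show j + 1 + n = j + n + 1 by ring]
    exact (smul_mono_right I ih).trans (hA.smul_le _)

theorem pow (I : Ideal R) : IsRees I (fun n => I ^ n • (⊤ : Submodule R M)) where
  smul_le n := by rw [← mul_smul, ← pow_succ']
  le_pow _ := le_rfl

theorem sup (hA : IsRees I A) (hB : IsRees I B) : IsRees I (A ⊔ B) where
  smul_le n := by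
    rw [Pi.sup_apply, Pi.sup_apply, Submodule.smul_sup]
    exact sup_le_sup (hA.smul_le n) (hB.smul_le n)
  le_pow n := sup_le (hA.le_pow n) (hB.le_pow n)

theorem smul (hA : IsRees I A) (J : Ideal R) : IsRees I (fun n => J • A n) where
  smul_le n := by
    rw [← mul_smul, mul_comm, mul_smul]
    exact smul_mono_right J (hA.smul_le n)
  le_pow n := Submodule.smul_le_right.trans (hA.le_pow n)

theorem shift (hA : IsRees I A) (c : ℕ) : IsRees I (fun n => A (n + c)) where
  smul_le n := by
    rw [show n + 1 + c = n + c + 1 by ring]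
    exact hA.smul_le _
  le_pow n := (hA.le_pow _).trans
    (Submodule.smul_mono_left (Ideal.pow_le_pow_right (by omega)))

/-- The graded submodule of the Rees module with components `A n`. -/
def hat (hA : IsRees I A) : Submodule (reesAlgebra I) (PolynomialModule R M) where
  carrier := { f | ∀ i, f.coeff i ∈ A i }
  add_mem' hf hg i := Submodule.add_mem _ (hf i) (hg i)
  zero_mem' _ := Submodule.zero_mem _
  smul_mem' r f hf i := by
    rw [Subalgebra.smul_def, PolynomialModule.smul_apply]
    apply Submodule.sum_mem
    rintro ⟨j, k⟩ e
    rw [Finset.HasAntidiagonal.mem_antidiagonal] at e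
    subst e
    exact hA.pow_smul_le j k (Submodule.smul_mem_smul (r.2 j) (hf k))

theorem mem_hat (hA : IsRees I A) {f : PolynomialModule R M} :
    f ∈ hA.hat ↔ ∀ i, f.coeff i ∈ A i := Iff.rfl

theorem single_mem_hat (hA : IsRees I A) {n : ℕ} {x : M} :
    single R n x ∈ hA.hat ↔ x ∈ A n := by
  rw [mem_hat]
  constructor
  · intro h
    simpa using h n
  · intro h i
    rw [coeff_single, Finsupp.single_apply]
    split_ifs with e
    · rwa [← e]
    · exact Submodule.zero_mem _

variable [IsNoetherianRing R] [Module.Finite R M]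

theorem isNoetherian_hat (hA : IsRees I A) : IsNoetherian (reesAlgebra I) hA.hat := by
  have h1 : (I.stableFiltration (⊤ : Submodule R M)).submodule.FG :=
    (Ideal.Filtration.submodule_fg_iff_stable _ fun i => IsNoetherian.noetherian _).2
      (I.stableFiltration_stable ⊤)
  have h2 := isNoetherian_of_fg_of_noetherian _ h1
  exact isNoetherian_of_le (t := (I.stableFiltration (⊤ : Submodule R M)).submodule)
    fun f hf i => hA.le_pow i (hf i)

/-- The Rees module is Noetherian over the Rees algebra, which makes the stabilization index uniform
over all degrees `n`. -/
theorem chain_stabilizes {C : ℕ → ℕ → Submodule R M} (hC : ∀ t, IsRees I (C t))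
    (hmono : Monotone C) : ∃ t₀, ∀ t ≥ t₀, C t = C t₀ := by
  have hT := isNoetherian_hat (IsRees.pow (M := M) I)
  let T := (IsRees.pow (M := M) I).hat
  let F : ℕ →o Submodule (reesAlgebra I) T :=
    { toFun := fun t => (hC t).hat.comap T.subtype
      monotone' := fun s t hst f hf i => hmono hst i (hf i) }
  obtain ⟨t₀, ht₀⟩ := monotone_stabilizes_iff_noetherian.2 hT F
  refine ⟨t₀, fun t ht => le_antisymm (fun n x hx => ?_) (hmono ht)⟩
  let y : T := ⟨single R n x, (IsRees.pow (M := M) I).single_mem_hat.2 ((hC t).le_pow n hx)⟩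
  have hy : y ∈ F t := (hC t).single_mem_hat.2 hx
  rw [← ht₀ t ht] at hy
  exact (hC t₀).single_mem_hat.1 hy

theorem exists_forall_eq_smul (hA : IsRees I A) : ∃ n₀, ∀ n ≥ n₀, A (n + 1) = I • A n := by
  -- `C k` is the graded submodule generated by the components of `A` in degrees at most `k`; its
  -- stabilization says that `A` is generated in bounded degree.
  let C : ℕ → ℕ → Submodule R M := fun k n => if n ≤ k then A n else I ^ (n - k) • A k
  have hC : ∀ k, IsRees I (C k) := by
    intro k
    constructor
    · intro n
      simp only [C]
      split_ifs with h1 h2 h2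
      · exact hA.smul_le n
      · obtain rfl : n = k := by omega
        simp
      · omega
      · rw [← mul_smul, ← pow_succ', show n - k + 1 = n + 1 - k by omega]
    · intro n
      simp only [C]
      split_ifs with h1
      · exact hA.le_pow n
      · refine (hA.pow_smul_le _ _).trans ?_
        rw [show n - k + k = n by omega]
        exact hA.le_pow n
  have hmono : Monotone C := by
    refine monotone_nat_of_le_succ fun k n => ?_
    simp only [C]
    split_ifs with h1 h2 h2
    · exact le_rfl
    · omega
    · obtain rfl : n = k + 1 := by omega
      simpa using hA.smul_le k
    · rw [show n - k = (n - (k + 1)) + 1 by omega, pow_succ, mul_smul]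
      exact smul_mono_right _ (hA.smul_le k)
  obtain ⟨n₀, hn₀⟩ := chain_stabilizes hC hmono
  refine ⟨n₀, fun n hn => ?_⟩
  have h := congrFun ((hn₀ (n + 1) (by omega)).trans (hn₀ n hn).symm) (n + 1)
  simpa [C] using h

theorem exists_forall_eq_pow_smul (hA : IsRees I A) :
    ∃ n₀, ∀ n ≥ n₀, ∀ j, A (n + j) = I ^ j • A n := by
  obtain ⟨n₀, hn₀⟩ := hA.exists_forall_eq_smul
  refine ⟨n₀, fun n hn j => ?_⟩
  induction j with
  | zero => simp
  | succ j ih => rw [← add_assoc, hn₀ _ (by omega), ih, pow_succ', mul_smul]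

/-- The constant `c` serves all `n` at once because Artin–Rees is applied to a single module over
the Rees algebra, with the extension of `J`. The maps `φ` and `ψ` below pass to degree `n` and back.
-/
theorem artinRees (hA : IsRees I A) (hB : IsRees I B) (hBA : B ≤ A) (J : Ideal R) :
    ∃ c, ∀ i n, B n ⊓ J ^ (i + c) • A n ≤ J ^ i • B n := by
  have := hA.isNoetherian_hat
  let J' : Ideal (reesAlgebra I) := J.map (algebraMap R (reesAlgebra I))
  let N : Submodule (reesAlgebra I) hA.hat := hB.hat.comap hA.hat.subtype
  obtain ⟨c, hc⟩ := Ideal.exists_pow_inf_eq_pow_smul (R := reesAlgebra I) (M := hA.hat) J' N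
  refine ⟨c, fun i n x hx => ?_⟩
  have hc := hc (i + c) (by omega)
  rw [Nat.add_sub_cancel] at hc
  let φ : A n →ₗ[R] hA.hat :=
    { toFun := fun a => ⟨single R n a, hA.single_mem_hat.2 a.2⟩
      map_add' := fun a b => Subtype.ext (by simp [single_add])
      map_smul' := fun r a => Subtype.ext (by simp [single_smul]) }
  let ψ : hA.hat →ₗ[R] M :=
    { toFun := fun f => f.1.coeff n
      map_add' := fun a b => by simp
      map_smul' := fun r a => by rfl }
  have key : ∀ (j : ℕ) (Q : Submodule (reesAlgebra I) hA.hat),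
      (J' ^ j • Q).restrictScalars R = J ^ j • Q.restrictScalars R := by
    intro j Q
    rw [← Ideal.map_pow, Ideal.smul_restrictScalars]
  have hxA : x ∈ A n := hBA n hx.1
  have h1 : φ ⟨x, hxA⟩ ∈ (J' ^ (i + c) • (⊤ : Submodule (reesAlgebra I) hA.hat)) := by
    have h2 : (⟨x, hxA⟩ : A n) ∈ J ^ (i + c) • (⊤ : Submodule R (A n)) := by
      have h3 : J ^ (i + c) • A n = (J ^ (i + c) • (⊤ : Submodule R (A n))).map (A n).subtype := by
        rw [Submodule.map_smul'', Submodule.map_top, Submodule.range_subtype]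
      have h4 := hx.2
      rw [h3] at h4
      obtain ⟨y, hy, hyx⟩ := h4
      have : y = ⟨x, hxA⟩ := Subtype.ext hyx
      rwa [← this]
    rw [← Submodule.restrictScalars_mem R, key]
    have h5 := Submodule.mem_map_of_mem (f := φ) h2
    rw [Submodule.map_smul''] at h5
    exact Submodule.smul_mono le_rfl (fun _ _ => Submodule.mem_top) h5
  have h2 : φ ⟨x, hxA⟩ ∈ N := hB.single_mem_hat.2 hx.1
  have h3 : φ ⟨x, hxA⟩ ∈ J' ^ i • N := by
    have : φ ⟨x, hxA⟩ ∈ J' ^ (i + c) • (⊤ : Submodule (reesAlgebra I) hA.hat) ⊓ N := ⟨h1, h2⟩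
    rw [hc] at this
    exact Submodule.smul_mono le_rfl inf_le_right this
  rw [← Submodule.restrictScalars_mem R, key] at h3
  have h4 := Submodule.mem_map_of_mem (f := ψ) h3
  rw [Submodule.map_smul''] at h4
  have h5 : ψ (φ ⟨x, hxA⟩) = x := by
    change (single R n x).coeff n = x
    simp
  rw [h5] at h4
  refine Submodule.smul_mono le_rfl ?_ h4
  rintro _ ⟨f, hf, rfl⟩
  exact hf n

end IsRees

end Rees

/-! ### Avoidance over an infinite residue field -/

section Avoidance

variable {R : Type u} [CommRing R] [IsLocalRing R] [Infinite (IsLocalRing.ResidueField R)]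

/-- If finitely many submodules covered `I`, one of them would have finite index. Some `x ∈ I` lies
outside it, so `R` modulo a proper ideal would be finite, and with it the residue field. Primeness
plays no role, so degree-one parts of primes of the Rees algebra are allowed. -/
theorem exists_mem_forall_notMem {I : Ideal R} {S : Set (Ideal R)} (hS : S.Finite)
    (h : ∀ W ∈ S, ¬ I ≤ W) : ∃ a ∈ I, ∀ W ∈ S, a ∉ W := by
  classical
  by_contra! hcon
  let s : Finset (Submodule R I) := hS.toFinset.image fun W => W.submoduleOf I
  have hcov : ⋃ p ∈ s, (p : Set I) = Set.univ := by
    refine Set.eq_univ_of_forall fun a => ?_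
    obtain ⟨W, hW, haW⟩ := hcon a a.2
    simp only [Set.mem_iUnion, s]
    exact ⟨W.submoduleOf I, Finset.mem_image_of_mem _ (hS.mem_toFinset.2 hW), haW⟩
  obtain ⟨p, hp, hfi⟩ := Submodule.exists_finiteIndex_of_cover hcov
  obtain ⟨W, hW, rfl⟩ := Finset.mem_image.1 hp
  rw [hS.mem_toFinset] at hW
  obtain ⟨x, hxI, hxW⟩ := Set.not_subset.1 (h W hW)
  have hfin : Finite (I ⧸ W.submoduleOf I) := AddSubgroup.finite_quotient_of_finiteIndex
  let f : R →ₗ[R] (I ⧸ W.submoduleOf I) :=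
    LinearMap.toSpanSingleton R _ (Submodule.Quotient.mk ⟨x, hxI⟩)
  have hker : LinearMap.ker f ≤ IsLocalRing.maximalIdeal R := by
    refine IsLocalRing.le_maximalIdeal fun htop => hxW ?_
    have h1 : (1 : R) ∈ LinearMap.ker f := by rw [htop]; trivial
    rw [LinearMap.mem_ker, LinearMap.toSpanSingleton_apply, one_smul,
      Submodule.Quotient.mk_eq_zero] at h1
    exact h1
  have hfin2 : Finite (R ⧸ LinearMap.ker f) :=
    Finite.of_injective _ (LinearMap.ker_eq_bot.1 (Submodule.ker_liftQ_eq_bot _ f le_rfl le_rfl))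
  have hsurj : Function.Surjective (Submodule.factor hker) := Submodule.factor_surjective hker
  have : Finite (IsLocalRing.ResidueField R) := Finite.of_surjective _ hsurj
  exact not_finite (IsLocalRing.ResidueField R)

end Avoidance

/-! ### Filter-regular elements of degree one -/

section FilterRegular

open PolynomialModule

variable {R : Type u} [CommRing R] {M : Type v} [AddCommGroup M] [Module R M] {I : Ideal R}

/-- The elements `x` of `A n` with `a • x ∈ B (n + c)`. -/
def colon (A B : ℕ → Submodule R M) (a : R) (c : ℕ) : ℕ → Submodule R M :=
  fun n => A n ⊓ (B (n + c)).comap (LinearMap.lsmul R M a)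

theorem IsRees.colon {A B : ℕ → Submodule R M} (hA : IsRees I A) (hB : IsRees I B) (a : R) (c : ℕ) :
    IsRees I (colon A B a c) where
  smul_le n := by
    refine Submodule.smul_le.2 fun r hr x hx => ⟨?_, ?_⟩
    · exact hA.smul_le n (Submodule.smul_mem_smul hr hx.1)
    · have h : r • a • x ∈ B (n + c + 1) := hB.smul_le _ (Submodule.smul_mem_smul hr hx.2)
      rw [smul_comm, show n + c + 1 = n + 1 + c by ring] at h
      exact h
  le_pow n := inf_le_left.trans (hA.le_pow n)

/-- The element `r t ^ j` of the Rees algebra. -/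
def reesMonomial (I : Ideal R) (j : ℕ) : ↥(I ^ j) →ₗ[R] reesAlgebra I where
  toFun r := ⟨Polynomial.monomial j (r : R), reesAlgebra.monomial_mem.2 r.2⟩
  map_add' r s := Subtype.ext (by simp)
  map_smul' c r := Subtype.ext (by simp [Polynomial.smul_monomial])

theorem reesMonomial_mem_span_pow {j : ℕ} {r : R} (hr : r ∈ I ^ j) :
    reesMonomial I j ⟨r, hr⟩ ∈ Ideal.span (Set.range (reesMonomial I 1)) ^ j := by
  induction j generalizing r with
  | zero => simp
  | succ j ih =>
    have hr' := hr
    rw [pow_succ'] at hr'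
    -- The membership proof is part of the statement, so that the induction on products and sums can
    -- carry it along.
    suffices h : ∃ h : r ∈ I ^ (j + 1), reesMonomial I (j + 1) ⟨r, h⟩ ∈
        Ideal.span (Set.range (reesMonomial I 1)) ^ (j + 1) from h.2
    refine Submodule.mul_induction_on (C := fun r => ∃ h : r ∈ I ^ (j + 1),
      reesMonomial I (j + 1) ⟨r, h⟩ ∈ Ideal.span (Set.range (reesMonomial I 1)) ^ (j + 1))
      hr' ?_ ?_
    · intro b hb s hs
      have hbs : b * s ∈ I ^ (j + 1) := by
        rw [pow_succ']
        exact Ideal.mul_mem_mul hb hs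
      have h : reesMonomial I (j + 1) ⟨b * s, hbs⟩ =
          reesMonomial I 1 ⟨b, by simpa using hb⟩ * reesMonomial I j ⟨s, hs⟩ :=
        Subtype.ext (by simp [reesMonomial, Polynomial.monomial_mul_monomial, add_comm])
      refine ⟨hbs, ?_⟩
      rw [h, pow_succ']
      exact Ideal.mul_mem_mul (Ideal.subset_span ⟨_, rfl⟩) (ih hs)
    · rintro x y ⟨hx, hx'⟩ ⟨hy, hy'⟩
      refine ⟨add_mem hx hy, ?_⟩
      have h3 := Ideal.add_mem _ hx' hy'
      rw [← map_add] at h3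
      exact h3

/-- Take the associated primes of `T / (T ∩ N)`. The minimal primes over the annihilator of the
`s`-torsion are among them and contain `s`, so `𝔤` lies in the radical of that annihilator and a
power of `𝔤` kills the torsion. -/
theorem exists_finite_primes_colon {S : Type u} [CommRing S] [IsNoetherianRing S] {Z : Type v}
    [AddCommGroup Z] [Module S Z] (T N : Submodule S Z) [IsNoetherian S T] :
    ∃ Ps : Set (Ideal S), Ps.Finite ∧ ∀ (s : S) (𝔤 : Ideal S), (∀ P ∈ Ps, s ∈ P → 𝔤 ≤ P) →
      ∃ m, ∀ z ∈ T, s • z ∈ N → ∀ g ∈ 𝔤 ^ m, g • z ∈ N := by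
  let N' : Submodule S T := N.comap T.subtype
  refine ⟨associatedPrimes S (T ⧸ N'), associatedPrimes.finite _ _, fun s 𝔤 h => ?_⟩
  let Y : Submodule S (T ⧸ N') := Submodule.torsionBy S (T ⧸ N') s
  have hrad : 𝔤 ≤ (Module.annihilator S Y).radical := by
    rw [← Ideal.sInf_minimalPrimes]
    refine le_sInf fun P hP => ?_
    refine h P (associatedPrimes.subset_of_injective (f := Y.subtype) Y.subtype_injective
      (Module.associatedPrimes.minimalPrimes_annihilator_subset_associatedPrimes _ _ hP)) ?_
    exact hP.1.2 (Module.mem_annihilator.2 fun y => Subtype.ext y.2)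
  obtain ⟨m, hm⟩ := Ideal.exists_pow_le_of_le_radical_of_fg hrad (IsNoetherian.noetherian _)
  refine ⟨m, fun z hz hsz g hg => ?_⟩
  have hy : N'.mkQ ⟨z, hz⟩ ∈ Y := by
    rw [Submodule.mem_torsionBy_iff, ← _root_.map_smul, Submodule.mkQ_apply,
      Submodule.Quotient.mk_eq_zero]
    exact hsz
  have h1 := Module.mem_annihilator.1 (hm hg) ⟨N'.mkQ ⟨z, hz⟩, hy⟩
  have h2 : g • N'.mkQ ⟨z, hz⟩ = 0 := congrArg Subtype.val h1
  rwa [← _root_.map_smul, Submodule.mkQ_apply, Submodule.Quotient.mk_eq_zero] at h2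

variable [IsNoetherianRing R] [Module.Finite R M] [IsLocalRing R]
  [Infinite (IsLocalRing.ResidueField R)]

/-- The element `a t` is chosen outside every associated prime of `A / B` that does not contain the
irrelevant ideal. Then a power of the irrelevant ideal kills the kernel of `a t` on `A / B`; this
kernel is generated in bounded degree, so it vanishes in high degrees. -/
theorem exists_filterRegular {A B : ℕ → Submodule R M} (hA : IsRees I A) (hB : IsRees I B)
    {S : Set (Ideal R)} (hS : S.Finite) (h : ∀ W ∈ S, ¬ I ≤ W) :
    ∃ a ∈ I, (∀ W ∈ S, a ∉ W) ∧ ∃ n₀, ∀ n ≥ n₀, ∀ x ∈ A n, a • x ∈ B (n + 1) → x ∈ B n := by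
  have := hA.isNoetherian_hat
  obtain ⟨Ps, hPs, hcolon⟩ := exists_finite_primes_colon (S := reesAlgebra I) hA.hat hB.hat
  let τ : I → reesAlgebra I := fun b => reesMonomial I 1 ⟨b, by simp⟩
  -- `W P` is the degree-one part of `P`, an ideal inside `I`. If it is all of `I`, then `P`
  -- contains the irrelevant ideal and need not be avoided.
  let W : Ideal (reesAlgebra I) → Ideal R := fun P =>
    ((P.restrictScalars R).comap (reesMonomial I 1)).map (I ^ 1).subtype
  have hWmem : ∀ P, ∀ b : I, (b : R) ∈ W P ↔ τ b ∈ P := by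
    intro P b
    constructor
    · rintro ⟨c, hc, hcb⟩
      have : c = ⟨b, by simp⟩ := Subtype.ext hcb
      rw [this] at hc
      exact hc
    · intro hb
      exact ⟨⟨b, by simp⟩, hb, rfl⟩
  obtain ⟨a, haI, ha⟩ := exists_mem_forall_notMem (I := I) (S := S ∪ {Q ∈ W '' Ps | ¬ I ≤ Q})
    (hS.union ((hPs.image W).subset (Set.sep_subset _ _)))
    (by rintro Q (hQ | hQ); exacts [h Q hQ, hQ.2])
  refine ⟨a, haI, fun Q hQ => ha Q (Or.inl hQ), ?_⟩
  obtain ⟨m, hm⟩ := hcolon (τ ⟨a, haI⟩) (Ideal.span (Set.range (reesMonomial I 1))) (by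
    intro P hP haP
    rw [Ideal.span_le]
    rintro _ ⟨b, rfl⟩
    have hbI : (b : R) ∈ I := by simpa using b.2
    by_contra hb
    refine ha (W P) (Or.inr ⟨⟨P, hP, rfl⟩, fun hle => hb ?_⟩) ((hWmem P ⟨a, haI⟩).2 haP)
    exact (hWmem P ⟨b, hbI⟩).1 (hle hbI))
  have hK := hA.colon hB a 1
  obtain ⟨n₀, hn₀⟩ := hK.exists_forall_eq_pow_smul
  refine ⟨n₀ + m, fun n hn x hxA hxB => ?_⟩
  have hx : x ∈ colon A B a 1 (n - m + m) := by
    rw [Nat.sub_add_cancel (by omega)]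
    exact ⟨hxA, hxB⟩
  rw [hn₀ (n - m) (by omega) m] at hx
  have hle : I ^ m • colon A B a 1 (n - m) ≤ B n := by
    refine Submodule.smul_le.2 fun r hr z hz => ?_
    have h1 : (Polynomial.monomial 1 a : Polynomial R) • single R (n - m) z ∈ hB.hat := by
      rw [monomial_smul_single, hB.single_mem_hat, add_comm]
      exact hz.2
    have h3 : (Polynomial.monomial m r : Polynomial R) • single R (n - m) z ∈ hB.hat :=
      hm _ (hA.single_mem_hat.2 hz.1) h1 _ (reesMonomial_mem_span_pow hr)
    rwa [monomial_smul_single, hB.single_mem_hat, show m + (n - m) = n by omega] at h3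
  exact hle hx

end FilterRegular

/-! ### Multiplicity along the powers of an ideal, and its torsion part -/

section Mult

variable {R : Type u} [CommRing R] {M : Type v} [AddCommGroup M] [Module R M] {I : Ideal R}

/-- The upper limit of `length (A n / B n)` divided by the binomial weight of degree `k`. -/
def growth (k : ℕ) (A B : ℕ → Submodule R M) : ℝ≥0∞ :=
  limsup (fun n => rlen (A n) (B n) / weight k n) atTop

/-- The sequence `J ^ i A + B`. -/
def trunc (J : Ideal R) (A B : ℕ → Submodule R M) (i : ℕ) : ℕ → Submodule R M :=
  (fun n => J ^ i • A n) ⊔ B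

theorem le_trunc (J : Ideal R) (A B : ℕ → Submodule R M) (i : ℕ) : B ≤ trunc J A B i :=
  le_sup_right

theorem trunc_le {J : Ideal R} {A B : ℕ → Submodule R M} (h : B ≤ A) (i : ℕ) :
    trunc J A B i ≤ A :=
  sup_le (fun _ => Submodule.smul_le_right) h

theorem trunc_anti (J : Ideal R) (A B : ℕ → Submodule R M) : Antitone (trunc J A B) :=
  fun _ _ hij => sup_le_sup_right
    (fun _ => Submodule.smul_mono_left (Ideal.pow_le_pow_right hij)) B

theorem trunc_mono_right (J : Ideal R) (A : ℕ → Submodule R M) {B B' : ℕ → Submodule R M}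
    (h : B ≤ B') (i : ℕ) : trunc J A B i ≤ trunc J A B' i :=
  sup_le_sup_left h _

theorem IsRees.trunc {A B : ℕ → Submodule R M} (hA : IsRees I A) (hB : IsRees I B)
    (J : Ideal R) (i : ℕ) : IsRees I (trunc J A B i) :=
  (hA.smul (J ^ i)).sup hB

/-- The supremum over `i` of the growth of `A / (J ^ i A + B)`. -/
def mult (J : Ideal R) (k : ℕ) (A B : ℕ → Submodule R M) : ℝ≥0∞ :=
  ⨆ i, growth k A (trunc J A B i)

theorem growth_le_growth {N : Type w} [AddCommGroup N] [Module R N] {k : ℕ}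
    {A B : ℕ → Submodule R M} {A' B' : ℕ → Submodule R N}
    (h : ∀ᶠ n in atTop, rlen (A n) (B n) ≤ rlen (A' n) (B' n)) :
    growth k A B ≤ growth k A' B' :=
  limsup_le_limsup (h.mono fun _ hn => ENNReal.div_le_div_right hn _)

theorem growth_congr {N : Type w} [AddCommGroup N] [Module R N] {k : ℕ}
    {A B : ℕ → Submodule R M} {A' B' : ℕ → Submodule R N}
    (h : ∀ᶠ n in atTop, rlen (A n) (B n) = rlen (A' n) (B' n)) :
    growth k A B = growth k A' B' :=
  le_antisymm (growth_le_growth (h.mono fun _ => le_of_eq))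
    (growth_le_growth (h.mono fun _ => ge_of_eq))

theorem growth_anti_right {k : ℕ} (A : ℕ → Submodule R M) {B B' : ℕ → Submodule R M}
    (h : B ≤ B') : growth k A B' ≤ growth k A B :=
  growth_le_growth (Eventually.of_forall fun n => rlen_anti_right _ (h n))

theorem mult_congr {N : Type w} [AddCommGroup N] [Module R N] {J : Ideal R} {k : ℕ}
    {A B : ℕ → Submodule R M} {A' B' : ℕ → Submodule R N}
    (h : ∀ i, ∀ᶠ n in atTop, rlen (A n) (J ^ i • A n ⊔ B n) = rlen (A' n) (J ^ i • A' n ⊔ B' n)) :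
    mult J k A B = mult J k A' B' :=
  iSup_congr fun i => growth_congr (h i)

theorem monotone_growth_trunc (J : Ideal R) (k : ℕ) (A B : ℕ → Submodule R M) :
    Monotone fun i => growth k A (trunc J A B i) :=
  fun _ _ hij => growth_anti_right A (trunc_anti J A B hij)

/-- The sequence with terms `a A (n - 1) + B n`. -/
def cut (A B : ℕ → Submodule R M) (a : R) : ℕ → Submodule R M
  | 0 => B 0
  | n + 1 => (A n).map (LinearMap.lsmul R M a) ⊔ B (n + 1)

theorem le_cut (A B : ℕ → Submodule R M) (a : R) : B ≤ cut A B a := by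
  rintro (_ | n)
  · exact le_rfl
  · exact le_sup_right

theorem IsRees.map_le {A : ℕ → Submodule R M} (hA : IsRees I A) {a : R} (ha : a ∈ I) (n : ℕ) :
    (A n).map (LinearMap.lsmul R M a) ≤ A (n + 1) := by
  rintro _ ⟨x, hx, rfl⟩
  exact hA.smul_le n (Submodule.smul_mem_smul ha hx)

theorem cut_le {A B : ℕ → Submodule R M} (hA : IsRees I A) (h : B ≤ A) {a : R} (ha : a ∈ I) :
    cut A B a ≤ A := by
  rintro (_ | n)
  · exact h 0
  · exact sup_le (hA.map_le ha n) (h _)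

theorem IsRees.cut {A B : ℕ → Submodule R M} (hA : IsRees I A) (hB : IsRees I B)
    {a : R} (ha : a ∈ I) : IsRees I (cut A B a) where
  smul_le
    | 0 => (hB.smul_le 0).trans (le_cut A B a 1)
    | n + 1 => by
      change I • ((A n).map (LinearMap.lsmul R M a) ⊔ B (n + 1)) ≤
        (A (n + 1)).map (LinearMap.lsmul R M a) ⊔ B (n + 2)
      rw [Submodule.smul_sup, ← Submodule.map_smul'']
      exact sup_le_sup (Submodule.map_mono (hA.smul_le n)) (hB.smul_le _)
  le_pow
    | 0 => hB.le_pow 0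
    | n + 1 => sup_le ((hA.map_le ha n).trans (hA.le_pow _)) (hB.le_pow _)

theorem rlen_map_sup {A : Submodule R M} {B C : Submodule R M} {a : R}
    (h : ∀ x ∈ A, a • x ∈ C ↔ x ∈ B) :
    rlen (A.map (LinearMap.lsmul R M a) ⊔ C) C = rlen A B := by
  rw [rlen_sup, rlen_map, ← rlen_inf A B, ← rlen_inf A (C.comap _)]
  congr 1
  ext x
  simp only [Submodule.mem_inf, Submodule.mem_comap, LinearMap.lsmul_apply]
  exact and_congr_right fun hx => h x hx

theorem rlen_succ_eq {A B : ℕ → Submodule R M} (hA : IsRees I A) (hB : IsRees I B) (hBA : B ≤ A)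
    {a : R} (ha : a ∈ I) {n : ℕ} (hreg : ∀ x ∈ A n, a • x ∈ B (n + 1) → x ∈ B n) :
    rlen (A (n + 1)) (B (n + 1)) = rlen (A n) (B n) + rlen (A (n + 1)) (cut A B a (n + 1)) := by
  rw [rlen_add (le_cut A B a (n + 1)) (cut_le hA hBA ha (n + 1)), add_comm]
  congr 1
  exact rlen_map_sup fun x hx => ⟨hreg x hx, fun h => hB.smul_le n (Submodule.smul_mem_smul ha h)⟩

theorem le_colon {A B : ℕ → Submodule R M} (hBA : B ≤ A) (a : R) : B ≤ colon A B a 0 :=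
  fun n _ hx => ⟨hBA n hx, (B n).smul_mem a hx⟩

theorem colon_le (A B : ℕ → Submodule R M) (a : R) : colon A B a 0 ≤ A := fun _ => inf_le_left

variable [IsNoetherianRing R] [Module.Finite R M] [IsLocalRing R]
  [Infinite (IsLocalRing.ResidueField R)]

/-- Beyond some degree the lengths of `A / B` differ by those of `A / (a A + B)`, to which the
induction on `k` applies. For `k = 0` the lengths are eventually nondecreasing. The limit may be
infinite, so no dimension bound is required. -/
theorem exists_tendsto_rlen {A B : ℕ → Submodule R M} (hA : IsRees I A) (hB : IsRees I B)
    (hBA : B ≤ A) (k : ℕ) :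
    ∃ L, Tendsto (fun n => rlen (A n) (B n) / weight k n) atTop (𝓝 L) := by
  induction k generalizing B with
  | zero =>
    obtain ⟨a, ha, -, n₀, hn₀⟩ := exists_filterRegular hA hB Set.finite_empty (by simp)
    have hmono : Monotone fun n => rlen (A (n + n₀)) (B (n + n₀)) := by
      refine monotone_nat_of_le_succ fun n => ?_
      rw [show n + 1 + n₀ = n + n₀ + 1 by ring, rlen_succ_eq hA hB hBA ha (hn₀ _ (by omega))]
      exact le_self_add
    refine ⟨⨆ n, rlen (A (n + n₀)) (B (n + n₀)), ?_⟩
    simp_rw [weight_zero, div_one]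
    exact (tendsto_add_atTop_iff_nat (f := fun n => rlen (A n) (B n)) n₀).1
      (tendsto_atTop_iSup hmono)
  | succ k ih =>
    obtain ⟨a, ha, -, n₀, hn₀⟩ := exists_filterRegular hA hB Set.finite_empty (by simp)
    obtain ⟨L, hL⟩ := ih (hA.cut hB ha) (cut_le hA hBA ha)
    exact exists_tendsto_div_weight_succ (n₀ := n₀)
      (fun n hn => rlen_succ_eq hA hB hBA ha (hn₀ n hn)) hL

theorem tendsto_growth {A B : ℕ → Submodule R M} (hA : IsRees I A) (hB : IsRees I B)
    (hBA : B ≤ A) (k : ℕ) :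
    Tendsto (fun n => rlen (A n) (B n) / weight k n) atTop (𝓝 (growth k A B)) := by
  obtain ⟨L, hL⟩ := exists_tendsto_rlen hA hB hBA k
  have : growth k A B = L := hL.limsup_eq
  rwa [this]

theorem growth_add {A B C : ℕ → Submodule R M} (hA : IsRees I A) (hB : IsRees I B)
    (hC : IsRees I C) (hCB : C ≤ B) (hBA : B ≤ A) (k : ℕ) :
    growth k A C = growth k A B + growth k B C := by
  refine tendsto_nhds_unique (tendsto_growth hA hC (hCB.trans hBA) k) ?_
  refine ((tendsto_growth hA hB hBA k).add (tendsto_growth hB hC hCB k)).congr fun n => ?_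
  rw [← ENNReal.add_div, ← rlen_add (hCB n) (hBA n)]

theorem mult_add (J : Ideal R) {A B C : ℕ → Submodule R M} (hA : IsRees I A) (hB : IsRees I B)
    (hC : IsRees I C) (hCB : C ≤ B) (hBA : B ≤ A) (k : ℕ) :
    mult J k A C = mult J k A B + mult J k B C := by
  have h1 : ∀ i, growth k A (trunc J A C i) =
      growth k A (trunc J A B i) + growth k B (trunc J A C i) := by
    intro i
    rw [growth_add hA (hA.trunc hB J i) (hA.trunc hC J i) (trunc_mono_right J A hCB i)
      (trunc_le hBA i)]
    congr 1
    refine growth_congr (Eventually.of_forall fun n => ?_)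
    rw [← rlen_sup (B n)]
    congr 1
    change J ^ i • A n ⊔ B n = B n ⊔ (J ^ i • A n ⊔ C n)
    rw [sup_left_comm, sup_eq_left.2 (hCB n)]
  -- By Artin–Rees, the filtration that the `J ^ i A` induce on `B / C` is cofinal with the `J`-adic
  -- one, so both have the same supremum.
  have h2 : ⨆ i, growth k B (trunc J A C i) = mult J k B C := by
    refine le_antisymm (iSup_mono fun i => growth_anti_right B
      (sup_le_sup_right (fun n => smul_mono_right _ (hBA n)) C)) (iSup_le fun i => ?_)
    obtain ⟨c, hc⟩ := hA.artinRees hB hBA J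
    refine le_trans ?_ (le_iSup (fun i => growth k B (trunc J A C i)) (i + c))
    refine growth_le_growth (Eventually.of_forall fun n => ?_)
    rw [← rlen_inf (B n) (trunc J A C (i + c) n)]
    refine rlen_anti_right _ ?_
    change B n ⊓ (J ^ (i + c) • A n ⊔ C n) ≤ J ^ i • B n ⊔ C n
    rw [sup_comm, inf_comm, sup_inf_assoc_of_le _ (hCB n), inf_comm]
    exact sup_le le_sup_right ((hc i n).trans le_sup_left)
  rw [← h2]
  unfold mult
  rw [ENNReal.iSup_add_iSup_of_monotone (monotone_growth_trunc J k A B)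
    (fun i j hij => growth_anti_right B (trunc_anti J A C hij))]
  exact iSup_congr h1

/-- With `z = y ^ i`, multiplication by `z` identifies `A / B` with `(z A + B) / B`, so additivity
and finiteness leave `A / (z A + B)` with multiplicity zero. Since `z A ≤ J ^ i A`, this quotient
maps onto `A / (J ^ i A + B)`, whose growth is the `i`-th term of the supremum. -/
theorem mult_eq_zero_of_regular {J : Ideal R} {A B : ℕ → Submodule R M} (hA : IsRees I A)
    (hB : IsRees I B) (hBA : B ≤ A) {k : ℕ} {y : R} (hy : y ∈ J)
    (hreg : ∀ n, ∀ x ∈ A n, y • x ∈ B n → x ∈ B n) (hfin : mult J k A B ≠ ⊤) :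
    mult J k A B = 0 := by
  refine le_antisymm (iSup_le fun i => ?_) zero_le
  have hyi : ∀ n, ∀ x ∈ A n, y ^ i • x ∈ B n → x ∈ B n := by
    intro n x hx h
    induction i with
    | zero => simpa using h
    | succ i ih =>
      rw [pow_succ', mul_smul] at h
      exact ih (hreg n _ ((A n).smul_mem _ hx) h)
  have hzJ : y ^ i ∈ J ^ i := Ideal.pow_mem_pow hy i
  set z := y ^ i
  let f := LinearMap.lsmul R M z
  let D : ℕ → Submodule R M := (fun n => (A n).map f) ⊔ B
  have hfA : ∀ n, (A n).map f ≤ J ^ i • A n := by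
    rintro n _ ⟨x, hx, rfl⟩
    exact Submodule.smul_mem_smul hzJ hx
  have hD : IsRees I D := by
    refine IsRees.sup ⟨fun n => ?_, fun n => ?_⟩ hB
    · rw [← Submodule.map_smul'']
      exact Submodule.map_mono (hA.smul_le n)
    · exact (hfA n).trans (Submodule.smul_le_right.trans (hA.le_pow n))
  have hDA : D ≤ A := sup_le (fun n => (hfA n).trans Submodule.smul_le_right) hBA
  have hBD : B ≤ D := le_sup_right
  have h1 : mult J k D B = mult J k A B := by
    refine mult_congr fun j => Eventually.of_forall fun n => ?_
    have e1 : J ^ j • D n ⊔ B n = (J ^ j • A n).map f ⊔ B n := by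
      change J ^ j • ((A n).map f ⊔ B n) ⊔ B n = _
      rw [Submodule.smul_sup, Submodule.map_smul'', sup_assoc,
        sup_eq_right.2 (Submodule.smul_le_right : J ^ j • B n ≤ B n)]
    have e2 : D n = (A n).map f ⊔ ((J ^ j • A n).map f ⊔ B n) := by
      change (A n).map f ⊔ B n = _
      rw [← sup_assoc, sup_eq_left.2
        (Submodule.map_mono Submodule.smul_le_right : (J ^ j • A n).map f ≤ (A n).map f)]
    rw [e1, e2]
    refine rlen_map_sup fun x hx => ⟨fun h => ?_, fun h => ?_⟩
    · obtain ⟨_, ⟨w, hw, rfl⟩, b, hb, hwb⟩ := Submodule.mem_sup.1 h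
      have h2 : z • (x - w) ∈ B n := by
        rw [smul_sub, ← hwb]
        simpa [f] using hb
      have h3 := hyi n _ ((A n).sub_mem hx (Submodule.smul_le_right hw)) h2
      rw [show x = w + (x - w) by abel]
      exact Submodule.add_mem_sup hw h3
    · obtain ⟨w, hw, b, hb, rfl⟩ := Submodule.mem_sup.1 h
      rw [smul_add]
      exact Submodule.add_mem_sup ⟨w, hw, rfl⟩ ((B n).smul_mem _ hb)
  have h2 := mult_add J hA hD hB hBD hDA k
  rw [h1] at h2
  have h3 : mult J k A D = 0 := by
    have : 0 + mult J k A B = mult J k A D + mult J k A B := by rw [zero_add]; exact h2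
    exact ((ENNReal.add_left_inj hfin).1 this).symm
  rw [← h3]
  refine le_trans (growth_anti_right A ?_) (le_iSup (fun i => growth k A (trunc J A D i)) i)
  refine sup_le le_sup_left (sup_le (fun n => (hfA n).trans ?_) le_sup_right)
  exact le_sup_left (a := fun n => J ^ i • A n) (b := B) n

/-- The `y ^ t`-torsion stabilizes. Modulo the stable torsion `y` is regular, so that quotient
contributes nothing. -/
theorem exists_mult_colon_eq {J : Ideal R} {A B : ℕ → Submodule R M} (hA : IsRees I A)
    (hB : IsRees I B) (hBA : B ≤ A) {k : ℕ} {y : R} (hy : y ∈ J) (hfin : mult J k A B ≠ ⊤) :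
    ∃ t₀, (∀ t, colon A B (y ^ t) 0 ≤ colon A B (y ^ t₀) 0) ∧
      mult J k (colon A B (y ^ t₀) 0) B = mult J k A B := by
  have hmono : Monotone fun t => colon A B (y ^ t) 0 := by
    refine monotone_nat_of_le_succ fun t n x hx => ⟨hx.1, ?_⟩
    have : y • y ^ t • x ∈ B n := (B n).smul_mem y hx.2
    rwa [← mul_smul, ← pow_succ'] at this
  obtain ⟨t₀, ht₀⟩ := IsRees.chain_stabilizes (fun t => hA.colon hB (y ^ t) 0) hmono
  refine ⟨t₀, fun t => ?_, ?_⟩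
  · rcases le_total t t₀ with h | h
    · exact hmono h
    · exact (ht₀ t h).le
  · have h1 := mult_add J hA (hA.colon hB (y ^ t₀) 0) hB (le_colon hBA _) (colon_le A B _) k
    have h2 : mult J k A (colon A B (y ^ t₀) 0) = 0 := by
      refine mult_eq_zero_of_regular hA (hA.colon hB _ 0) (colon_le A B _) hy ?_ ?_
      · intro n x hx hyx
        rw [← ht₀ (t₀ + 1) (by omega)]
        refine ⟨hx, ?_⟩
        have : y ^ t₀ • y • x ∈ B n := hyx.2
        rwa [← mul_smul, ← pow_succ] at this
      · exact ne_top_of_le_ne_top hfin (h1 ▸ le_self_add)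
    rw [h1, h2, zero_add]

theorem exists_torsion {J : Ideal R} {A B : ℕ → Submodule R M} (hA : IsRees I A)
    (hB : IsRees I B) (hBA : B ≤ A) {k : ℕ} (hfin : mult J k A B ≠ ⊤) :
    ∃ K, IsRees I K ∧ B ≤ K ∧
      (∀ n x, x ∈ K n ↔ x ∈ A n ∧ ∃ T, ∀ r ∈ J ^ T, r • x ∈ B n) ∧
      (∃ T, ∀ n, J ^ T • K n ≤ B n) ∧ growth k K B = mult J k A B := by
  classical
  -- The torsion for one element of `J` at a time is taken, over a finite generating set. Each pass
  -- keeps the multiplicity and every element killed by a power of `J`.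
  have step : ∀ s : Finset R, (∀ y ∈ s, y ∈ J) → ∃ K, IsRees I K ∧ B ≤ K ∧ K ≤ A ∧
      (∀ n, ∀ x ∈ A n, (∃ T, ∀ r ∈ J ^ T, r • x ∈ B n) → x ∈ K n) ∧
      mult J k K B = mult J k A B ∧ ∃ t : R → ℕ, ∀ y ∈ s, ∀ n, ∀ x ∈ K n, y ^ t y • x ∈ B n := by
    intro s
    induction s using Finset.induction_on with
    | empty => exact fun _ => ⟨A, hA, hBA, le_rfl, fun n x hx _ => hx, rfl, 0, by simp⟩
    | insert y s hys ih =>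
      intro hs
      obtain ⟨K, hK, hBK, hKA, hT, hm, t, ht⟩ := ih fun z hz => hs z (Finset.mem_insert_of_mem hz)
      have hy : y ∈ J := hs y (Finset.mem_insert_self y s)
      obtain ⟨t₀, ht₀, hmt⟩ := exists_mult_colon_eq hK hB hBK hy (k := k) (hm ▸ hfin)
      refine ⟨colon K B (y ^ t₀) 0, hK.colon hB _ 0, le_colon hBK _, (colon_le K B _).trans hKA,
        ?_, hmt.trans hm, Function.update t y t₀, ?_⟩
      · rintro n x hx ⟨T, hTx⟩
        exact ht₀ T n ⟨hT n x hx ⟨T, hTx⟩, hTx _ (Ideal.pow_mem_pow hy T)⟩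
      · intro z hz n x hx
        rcases Finset.mem_insert.1 hz with rfl | hz
        · rw [Function.update_self]
          exact hx.2
        · rw [Function.update_of_ne (ne_of_mem_of_not_mem hz hys)]
          exact ht z hz n x hx.1
  obtain ⟨s, hs⟩ := (isNoetherianRing_iff_ideal_fg R).1 inferInstance J
  obtain ⟨K, hK, hBK, hKA, hT, hm, t, ht⟩ := step s fun y hy => hs ▸ Ideal.subset_span hy
  let b : Ideal R := Ideal.span ((fun y => y ^ t y) '' (s : Set R))
  have hrad : J ≤ b.radical := by
    rw [← hs, Ideal.span_le]
    exact fun y hy => ⟨t y, Ideal.subset_span ⟨y, hy, rfl⟩⟩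
  obtain ⟨T, hTb⟩ := Ideal.exists_pow_le_of_le_radical_of_fg hrad (IsNoetherian.noetherian _)
  have hbK : ∀ n, J ^ T • K n ≤ B n := by
    intro n
    refine (Submodule.smul_mono_left hTb).trans ?_
    rw [Submodule.span_smul_eq, Submodule.set_smul_le_iff]
    rintro _ x ⟨y, hy, rfl⟩ hx
    exact ht y hy n x hx
  refine ⟨K, hK, hBK, fun n x => ⟨fun hx => ⟨hKA n hx, T, fun r hr => ?_⟩,
    fun hx => hT n x hx.1 hx.2⟩, ⟨T, hbK⟩, ?_⟩
  · exact hbK n (Submodule.smul_mem_smul hr hx)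
  -- Since `J ^ T K ≤ B`, the truncation at `T` is `B` itself and the supremum is attained there.
  · rw [← hm]
    refine le_antisymm ?_ (iSup_le fun i => growth_anti_right K (le_trunc J K B i))
    refine le_trans (growth_anti_right K ?_) (le_iSup (fun i => growth k K (trunc J K B i)) T)
    exact sup_le hbK le_rfl

end Mult

/-! ### Additivity on short exact sequences -/

section Additivity

variable {R : Type u} [CommRing R] {I : Ideal R} {J : Ideal R} {k : ℕ}

/-- The multiplicity of degree `k` of the graded module `⨁ I ^ n M / I ^ (n + 1) M`, measured
along the powers of `J`. -/
def grMult (J : Ideal R) (k : ℕ) (I : Ideal R) (M : Type v) [AddCommGroup M] [Module R M] : ℝ≥0∞ :=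
  mult J k (fun n => I ^ n • (⊤ : Submodule R M)) (fun n => I ^ (n + 1) • (⊤ : Submodule R M))

theorem mult_eq_zero_of_eventually_le {M : Type v} [AddCommGroup M] [Module R M]
    {A B : ℕ → Submodule R M} (h : ∀ᶠ n in atTop, A n ≤ B n) : mult J k A B = 0 := by
  refine le_antisymm (iSup_le fun i => ?_) zero_le
  have h0 : growth k A (trunc J A B i) = limsup (fun _ => 0) (atTop : Filter ℕ) := by
    refine limsup_congr (h.mono fun n hn => ?_)
    rw [rlen_eq_zero_of_le (hn.trans (le_trunc J A B i n)), ENNReal.zero_div]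
  rw [h0, limsup_const]

theorem rlen_sup_inf {M : Type v} [AddCommGroup M] [Module R M] {A X L : Submodule R M}
    (h : X ≤ A) : rlen A (X ⊔ L) = rlen A (X ⊔ L ⊓ A) := by
  rw [← rlen_inf A (X ⊔ L), inf_comm, sup_inf_assoc_of_le _ h]

theorem grMult_eq_of_surjective {M : Type v} [AddCommGroup M] [Module R M] {N : Type w}
    [AddCommGroup N] [Module R N] (f : M →ₗ[R] N) (hf : Function.Surjective f) :
    grMult J k I N = mult J k (fun n => I ^ n • (⊤ : Submodule R M))
      (fun n => I ^ (n + 1) • (⊤ : Submodule R M) ⊔ LinearMap.ker f ⊓ I ^ n • ⊤) := by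
  refine mult_congr fun i => Eventually.of_forall fun n => ?_
  have h : ∀ j, I ^ j • (⊤ : Submodule R N) = (I ^ j • (⊤ : Submodule R M)).map f := by
    intro j
    rw [Submodule.map_smul'', Submodule.map_top, LinearMap.range_eq_top.2 hf]
  have hle : J ^ i • I ^ n • (⊤ : Submodule R M) ⊔ I ^ (n + 1) • ⊤ ≤ I ^ n • ⊤ :=
    sup_le Submodule.smul_le_right (Submodule.smul_mono_left (Ideal.pow_le_pow_right (by omega)))
  rw [h, h, ← Submodule.map_smul'', ← Submodule.map_sup, rlen_map, Submodule.comap_map_eq,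
    rlen_sup_inf hle, sup_assoc]

theorem grMult_eq_of_injective {M : Type v} [AddCommGroup M] [Module R M] {L : Type w}
    [AddCommGroup L] [Module R L] (f : L →ₗ[R] M) (hf : Function.Injective f) :
    grMult J k I L =
      mult J k (fun n => I ^ n • LinearMap.range f) (fun n => I ^ (n + 1) • LinearMap.range f) := by
  refine mult_congr fun i => Eventually.of_forall fun n => ?_
  simp only [← Submodule.map_top, ← Submodule.map_smul'', ← Submodule.map_sup]
  rw [rlen_map, Submodule.comap_map_eq_of_injective hf]

theorem grMult_congr {M : Type v} [AddCommGroup M] [Module R M] {N : Type w}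
    [AddCommGroup N] [Module R N] (e : M ≃ₗ[R] N) : grMult J k I M = grMult J k I N := by
  rw [grMult_eq_of_injective e.toLinearMap e.injective, e.range]
  rfl

variable [IsNoetherianRing R] [IsLocalRing R] [Infinite (IsLocalRing.ResidueField R)]
  {M : Type v} [AddCommGroup M] [Module R M] [Module.Finite R M]

theorem growth_shift {A B : ℕ → Submodule R M} (hA : IsRees I A) (hB : IsRees I B) (hBA : B ≤ A)
    (k c : ℕ) : growth k (fun n => A (n + c)) (fun n => B (n + c)) = growth k A B := by
  induction c with
  | zero => rfl
  | succ c ih =>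
    rw [← ih]
    have h := tendsto_growth (hA.shift c) (hB.shift c) (fun n => hBA (n + c)) k
    have h2 := (tendsto_div_weight_shift (f := fun n => rlen (A (n + c)) (B (n + c))) h).limsup_eq
    rw [← h2]
    refine limsup_congr (Eventually.of_forall fun n => ?_)
    simp only [show n + (c + 1) = n + 1 + c by ring]

theorem mult_shift {A B : ℕ → Submodule R M} (hA : IsRees I A) (hB : IsRees I B) (hBA : B ≤ A)
    (J : Ideal R) (k c : ℕ) :
    mult J k (fun n => A (n + c)) (fun n => B (n + c)) = mult J k A B :=
  iSup_congr fun i => growth_shift hA (hA.trunc hB J i) (trunc_le hBA i) k c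

theorem mult_shift_ne_top {A : ℕ → Submodule R M} (hA : IsRees I A) (hmono : Antitone A)
    (h : mult J k A (fun n => A (n + 1)) ≠ ⊤) (c : ℕ) :
    mult J k A (fun n => A (n + c)) ≠ ⊤ := by
  induction c with
  | zero =>
    have h0 : mult J k A (fun n => A (n + 0)) = 0 :=
      mult_eq_zero_of_eventually_le (Eventually.of_forall fun n => le_rfl)
    exact h0 ▸ ENNReal.zero_ne_top
  | succ c ih =>
    rw [mult_add J hA (hA.shift c) (hA.shift (c + 1)) (fun n => hmono (by omega))
      (fun n => hmono (by omega))]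
    refine ENNReal.add_ne_top.2 ⟨ih, ?_⟩
    have h2 := mult_shift hA (hA.shift 1) (fun n => hmono (by omega)) J k c
    have h3 : (fun n => A (n + (c + 1))) = fun n => (fun n => A (n + 1)) (n + c) := by
      ext1 n
      simp only [show n + (c + 1) = n + c + 1 by ring]
    rw [h3, h2]
    exact h

/-- Let `F` be the induced filtration on `L` and `E` the `I`-adic one. Computing the multiplicity of
`F n / E (n + 1)` through `F (n + 1)` and through `E n` gives, by shift invariance, two sums sharing
the term for `F / E`. Artin–Rees gives `F (n + c) ≤ E n`, which makes this term finite and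
cancellable when `F n / F (n + 1)` has finite multiplicity. -/
theorem mult_inf_pow_eq (J : Ideal R) (k : ℕ) (I : Ideal R) (L : Submodule R M) :
    mult J k (fun n => L ⊓ I ^ n • (⊤ : Submodule R M)) (fun n => L ⊓ I ^ (n + 1) • ⊤) =
      mult J k (fun n => I ^ n • L) (fun n => I ^ (n + 1) • L) := by
  let F : ℕ → Submodule R M := fun n => L ⊓ I ^ n • ⊤
  let E : ℕ → Submodule R M := fun n => I ^ n • L
  have hA : Antitone fun n => I ^ n • (⊤ : Submodule R M) :=
    fun m n h => Submodule.smul_mono_left (Ideal.pow_le_pow_right h)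
  have hFm : Antitone F := fun m n h => inf_le_inf_left L (hA h)
  have hEm : Antitone E := fun m n h => Submodule.smul_mono_left (Ideal.pow_le_pow_right h)
  have hF : IsRees I F := by
    refine ⟨fun n => le_inf (Submodule.smul_le_right.trans inf_le_left) ?_, fun n => inf_le_right⟩
    exact (smul_mono_right I inf_le_right).trans ((IsRees.pow (M := M) I).smul_le n)
  have hE : IsRees I E := by
    refine ⟨fun n => ?_, fun n => smul_mono_right _ le_top⟩
    simp only [E]
    rw [← mul_smul, ← pow_succ']
  have hEF : E ≤ F := fun n => le_inf Submodule.smul_le_right (smul_mono_right _ le_top)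
  obtain ⟨c, hc⟩ := Ideal.exists_pow_inf_eq_pow_smul I L
  have hFE : ∀ n, F (n + c) ≤ E n := by
    intro n
    have h := hc (n + c) (by omega)
    rw [Nat.add_sub_cancel] at h
    simp only [F, E]
    rw [inf_comm, h]
    exact smul_mono_right _ inf_le_right
  change mult J k F (fun n => F (n + 1)) = mult J k E (fun n => E (n + 1))
  have s1 := mult_add J hF (hF.shift 1) (hE.shift 1) (fun n => hEF (n + 1))
    (fun n => hFm (by omega)) k
  have s2 := mult_add J hF hE (hE.shift 1) (fun n => hEm (by omega)) hEF k
  rw [mult_shift hF hE hEF J k 1] at s1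
  have key : mult J k F (fun n => F (n + 1)) ≠ ⊤ →
      mult J k F (fun n => F (n + 1)) = mult J k E (fun n => E (n + 1)) := by
    intro hfin
    have h1 : mult J k F E ≠ ⊤ := by
      have h2 := mult_add J hF hE (hF.shift c) hFE hEF k
      exact ne_top_of_le_ne_top (mult_shift_ne_top hF hFm hfin c) (h2 ▸ le_self_add)
    rw [s1, add_comm] at s2
    exact (ENNReal.add_right_inj h1).1 s2
  -- In the infinite case, `F (n + c) / F (n + c + 1)` is a subquotient of `E n / E (n + c + 1)`, so
  -- the multiplicity for `E` cannot be finite either.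
  by_cases hfin : mult J k F (fun n => F (n + 1)) = ⊤
  · rw [hfin]
    symm
    by_contra hE'
    have h1 := mult_shift_ne_top hE hEm hE' (c + 1)
    rw [mult_add J hE (hF.shift c) (hE.shift (c + 1)) (fun n => (hEF _).trans (hFm (by omega)))
      hFE k, mult_add J (hF.shift c) (hF.shift (c + 1)) (hE.shift (c + 1)) (fun n => hEF _)
      (fun n => hFm (by omega)) k] at h1
    have h3 : (fun n => F (n + (c + 1))) = fun n => (fun n => F (n + 1)) (n + c) := by
      ext1 n
      simp only [show n + (c + 1) = n + c + 1 by ring]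
    rw [h3, mult_shift hF (hF.shift 1) (fun n => hFm (by omega)) J k c, hfin] at h1
    simp at h1
  · exact key hfin

theorem grMult_add_of_exact (J : Ideal R) (k : ℕ) (I : Ideal R) {L : Type w} [AddCommGroup L]
    [Module R L] {N : Type x} [AddCommGroup N] [Module R N] (f : L →ₗ[R] M) (g : M →ₗ[R] N)
    (hf : Function.Injective f) (hg : Function.Surjective g) (hfg : Function.Exact f g) :
    grMult J k I M = grMult J k I L + grMult J k I N := by
  have hker : LinearMap.ker g = LinearMap.range f := LinearMap.exact_iff.1 hfg
  rw [grMult_eq_of_injective f hf, grMult_eq_of_surjective g hg, hker, ← mult_inf_pow_eq, add_comm]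
  set L' := LinearMap.range f
  let A : ℕ → Submodule R M := fun n => I ^ n • ⊤
  let F : ℕ → Submodule R M := fun n => L' ⊓ I ^ n • ⊤
  have hAm : Antitone A := fun m n h => Submodule.smul_mono_left (Ideal.pow_le_pow_right h)
  have hA : IsRees I A := IsRees.pow I
  have hF : IsRees I F := by
    refine ⟨fun n => le_inf (Submodule.smul_le_right.trans inf_le_left) ?_, fun n => inf_le_right⟩
    exact (smul_mono_right I inf_le_right).trans (hA.smul_le n)
  have hAA : ∀ n, A (n + 1) ≤ A n := fun n => hAm (by omega)
  change mult J k A (fun n => A (n + 1)) =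
    mult J k A ((fun n => A (n + 1)) ⊔ F) + mult J k F (fun n => F (n + 1))
  -- The upper layer is the graded module of `N`; the lower one is `F n / F (n + 1)` by the second
  -- isomorphism theorem.
  rw [mult_add J hA ((hA.shift 1).sup hF) (hA.shift 1) le_sup_left
    (sup_le hAA fun n => inf_le_right)]
  congr 1
  refine mult_congr fun i => Eventually.of_forall fun n => ?_
  have e1 : J ^ i • ((fun n => A (n + 1)) ⊔ F) n ⊔ A (n + 1) = J ^ i • F n ⊔ A (n + 1) := by
    change J ^ i • (A (n + 1) ⊔ F n) ⊔ A (n + 1) = _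
    rw [Submodule.smul_sup, sup_right_comm,
      sup_eq_right.2 (Submodule.smul_le_right : J ^ i • A (n + 1) ≤ A (n + 1)), sup_comm]
  have e2 : ((fun n => A (n + 1)) ⊔ F) n = F n ⊔ (J ^ i • F n ⊔ A (n + 1)) := by
    change A (n + 1) ⊔ F n = _
    rw [← sup_assoc, sup_eq_left.2 (Submodule.smul_le_right : J ^ i • F n ≤ F n), sup_comm]
  have e3 : A (n + 1) ⊓ F n = F (n + 1) := by
    change A (n + 1) ⊓ (L' ⊓ A n) = L' ⊓ A (n + 1)
    rw [inf_left_comm, inf_eq_left.2 (hAA n)]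
  rw [e1, e2, rlen_sup, rlen_sup_inf Submodule.smul_le_right, e3]

end Additivity

/-! ### Finiteness and vanishing by dimension -/

section Finiteness

open IsLocalRing
open scoped Pointwise

variable {R : Type u} [CommRing R] {I : Ideal R}

theorem grMult_eq_zero_of_pow_smul {M : Type v} [AddCommGroup M] [Module R M] {J : Ideal R} {k : ℕ}
    {T : ℕ} (h : I ^ T • (⊤ : Submodule R M) = ⊥) : grMult J k I M = 0 := by
  refine mult_eq_zero_of_eventually_le ?_
  filter_upwards [eventually_ge_atTop T] with n hn
  refine le_trans (Submodule.smul_mono_left (Ideal.pow_le_pow_right hn)) ?_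
  rw [h]
  exact bot_le

theorem rlen_le_add_of_map_le {M : Type v} [AddCommGroup M] [Module R M] {A A' T T' : Submodule R M}
    {a : R} (hT : T ≤ A) (hA : A'.map (LinearMap.lsmul R M a) ≤ A)
    (hT' : T'.map (LinearMap.lsmul R M a) ≤ T) :
    rlen A T ≤ rlen A' T' + rlen A (A'.map (LinearMap.lsmul R M a) ⊔ T) := by
  rw [rlen_add le_sup_right (sup_le hA hT), add_comm, rlen_sup, rlen_map]
  gcongr
  exact rlen_anti_right _ (Submodule.map_le_iff_le_comap.1 hT')

variable [IsNoetherianRing R]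

theorem isFiniteLength_of_le_annihilator {N : Type v} [AddCommGroup N] [Module R N]
    [Module.Finite R N] {b : Ideal R} [IsArtinianRing (R ⧸ b)] (h : b ≤ Module.annihilator R N) :
    IsFiniteLength R N := by
  have ht : Module.IsTorsionBySet R N b := fun x r => Module.mem_annihilator.1 (h r.2) x
  let _ := ht.module
  have : IsScalarTower R (R ⧸ b) N := ht.isScalarTower
  have : Module.Finite (R ⧸ b) N := Module.Finite.of_restrictScalars_finite R _ _
  rw [isFiniteLength_iff_isNoetherian_isArtinian]
  exact ⟨inferInstance, isArtinian_of_surjective_algebraMap (R := R ⧸ b) (S := R)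
    (Ideal.Quotient.mk_surjective (I := b))⟩

/-- Artin–Rees places `x` within a bounded number of degrees of `n` when `a x ∈ I ^ (n + 1) M`;
filter-regularity then raises its degree one step at a time. -/
theorem exists_inf_le_map {M : Type v} [AddCommGroup M] [Module R M] [Module.Finite R M]
    {a : R} (hreg : IsSMulRegular M a) {n₀ : ℕ}
    (h : ∀ n ≥ n₀, ∀ x ∈ I ^ n • (⊤ : Submodule R M), a • x ∈ I ^ (n + 1 + 1) • (⊤ : Submodule R M) →
      x ∈ I ^ (n + 1) • (⊤ : Submodule R M)) :
    ∃ n₁, ∀ n ≥ n₁, a • (⊤ : Submodule R M) ⊓ I ^ (n + 1) • ⊤ ≤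
      (I ^ n • (⊤ : Submodule R M)).map (LinearMap.lsmul R M a) := by
  obtain ⟨c, hc⟩ := Ideal.exists_pow_inf_eq_pow_smul I (a • (⊤ : Submodule R M))
  refine ⟨n₀ + c, fun n hn y hy => ?_⟩
  obtain ⟨x, -, rfl⟩ := hy.1
  have hbase : x ∈ I ^ (n + 1 - c) • (⊤ : Submodule R M) := by
    have h1 : a • x ∈ I ^ (n + 1) • (⊤ : Submodule R M) ⊓ a • ⊤ := ⟨hy.2, hy.1⟩
    rw [hc (n + 1) (by omega)] at h1
    have h2 : a • x ∈ I ^ (n + 1 - c) • a • (⊤ : Submodule R M) :=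
      Submodule.smul_mono le_rfl inf_le_right h1
    have h3 : I ^ (n + 1 - c) • a • (⊤ : Submodule R M) =
        (I ^ (n + 1 - c) • (⊤ : Submodule R M)).map (LinearMap.lsmul R M a) := by
      rw [Submodule.map_smul'']
      rfl
    rw [h3] at h2
    obtain ⟨z, hz, hzx⟩ := h2
    rwa [← hreg hzx]
  have hstep : ∀ m, n + 1 - c ≤ m → m ≤ n → x ∈ I ^ m • (⊤ : Submodule R M) := by
    intro m hm
    induction m, hm using Nat.le_induction with
    | base => exact fun _ => hbase
    | succ m hm ih =>
      intro hmn
      refine h m (by omega) x (ih (by omega)) ?_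
      exact Submodule.smul_mono_left (Ideal.pow_le_pow_right (by omega)) hy.2
  refine ⟨x, ?_, rfl⟩
  by_cases hc0 : n + 1 - c ≤ n
  · exact hstep n hc0 le_rfl
  · exact Submodule.smul_mono_left (Ideal.pow_le_pow_right (by omega)) hbase

variable [IsLocalRing R]

theorem isArtinianRing_quotient_maximalIdeal_pow (i : ℕ) :
    IsArtinianRing (R ⧸ maximalIdeal R ^ i) := by
  rcases Nat.eq_zero_or_pos i with rfl | hi
  · have : Subsingleton (R ⧸ maximalIdeal R ^ 0) := by
      rw [Ideal.Quotient.subsingleton_iff]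
      simp
    infer_instance
  · refine quotient_artinian_of_mem_minimalPrimes_of_isLocalRing _
      ⟨⟨inferInstance, Ideal.pow_le_self hi.ne'⟩, fun q hq _ => ?_⟩
    exact (hq.1.pow_le_iff hi.ne').1 hq.2

theorem rlen_ne_top_of_pow_smul_le {M : Type v} [AddCommGroup M] [Module R M] [Module.Finite R M]
    {A B : Submodule R M} {i : ℕ} (h : maximalIdeal R ^ i • A ≤ B) : rlen A B ≠ ⊤ := by
  have := isArtinianRing_quotient_maximalIdeal_pow (R := R) i
  refine rlen_ne_top_of_isFiniteLength (isFiniteLength_of_le_annihilator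
    (b := maximalIdeal R ^ i) fun r hr => Module.mem_annihilator.2 fun x => ?_)
  obtain ⟨x, rfl⟩ := Submodule.Quotient.mk_surjective _ x
  rw [← Submodule.Quotient.mk_smul, Submodule.Quotient.mk_eq_zero]
  exact h (Submodule.smul_mem_smul hr x.2)

theorem exists_pow_smul_eq_bot {M : Type v} [AddCommGroup M] [Module R M] [Module.Finite R M]
    (h : Module.supportDim R M ≤ 0) :
    ∃ T, maximalIdeal R ^ T • (⊤ : Submodule R M) = ⊥ := by
  rcases subsingleton_or_nontrivial M with hM | hM
  · exact ⟨0, Subsingleton.elim _ _⟩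
  · have h0 : Module.supportDim R M = 0 := by
      refine le_antisymm h ?_
      have := Module.supportDim_ne_bot_of_nontrivial R M
      rw [Module.supportDim] at this ⊢
      exact Order.krullDim_nonneg_iff.2 (Order.krullDim_ne_bot_iff.1 this)
    have h1 := support_of_supportDim_eq_zero R M h0
    rw [Module.support_eq_zeroLocus, PrimeSpectrum.zeroLocus_eq_iff] at h1
    obtain ⟨T, hT⟩ := Ideal.exists_pow_le_of_le_radical_of_fg
      (Ideal.le_radical.trans h1.ge) (IsNoetherian.noetherian (maximalIdeal R))
    refine ⟨T, le_bot_iff.1 (Submodule.smul_le.2 fun r hr x _ => ?_)⟩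
    exact Module.mem_annihilator.1 (hT hr) x

variable [Infinite (ResidueField R)]

theorem growth_succ_eq_zero {M : Type v} [AddCommGroup M] [Module R M] [Module.Finite R M]
    {A B : ℕ → Submodule R M} (hA : IsRees I A) (hB : IsRees I B) (hBA : B ≤ A) {k : ℕ}
    (h : growth k A B ≠ ⊤) : growth (k + 1) A B = 0 := by
  have h1 := ENNReal.Tendsto.mul (tendsto_growth hA hB hBA k) (Or.inr (by simp))
    (tendsto_weight_ratio k) (Or.inr h)
  rw [mul_zero] at h1
  refine (h1.congr fun n => ?_).limsup_eq
  simp only [div_eq_mul_inv]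
  calc rlen (A n) (B n) * (weight k n)⁻¹ * (weight k n * (weight (k + 1) n)⁻¹)
      = rlen (A n) (B n) * ((weight k n)⁻¹ * weight k n) * (weight (k + 1) n)⁻¹ := by ring
    _ = _ := by rw [ENNReal.inv_mul_cancel (weight_ne_zero _ _) (weight_ne_top _ _), mul_one]

theorem grMult_succ_eq_zero {M : Type v} [AddCommGroup M] [Module R M] [Module.Finite R M]
    {J : Ideal R} {k : ℕ} (h : grMult J k I M ≠ ⊤) : grMult J (k + 1) I M = 0 := by
  refine le_antisymm (iSup_le fun i => le_of_eq ?_) zero_le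
  have hA := IsRees.pow (M := M) I
  have hle : (fun n => I ^ (n + 1) • (⊤ : Submodule R M)) ≤ fun n => I ^ n • ⊤ :=
    fun n => Submodule.smul_mono_left (Ideal.pow_le_pow_right (by omega))
  refine growth_succ_eq_zero hA (hA.trunc (hA.shift 1) J i) (trunc_le hle i) ?_
  exact ne_top_of_le_ne_top h (le_iSup (fun i => growth k (fun n => I ^ n • (⊤ : Submodule R M))
    (trunc J (fun n => I ^ n • (⊤ : Submodule R M)) (fun n => I ^ (n + 1) • ⊤) i)) i)

/-- If `I ≤ p`, the graded module vanishes in positive degrees. Otherwise a filter-regular `a ∈ I`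
outside `p` cuts the dimension by one, and the multiplicity in degree `k` is bounded by that of the
quotient in degree `k - 1`. -/
theorem grMult_quotient_prime_ne_top (hI : I ≠ ⊤) {p : Ideal R} [p.IsPrime] {k : ℕ}
    (hdim : Module.supportDim R (R ⧸ p) ≤ ((k + 1 : ℕ) : WithBot ℕ∞))
    (ih : ∀ l, k = l + 1 → ∀ (N : Type u) [AddCommGroup N] [Module R N] [Module.Finite R N],
      Module.supportDim R N ≤ ((l + 1 : ℕ) : WithBot ℕ∞) →
        grMult (maximalIdeal R) l I N ≠ ⊤) :
    grMult (maximalIdeal R) k I (R ⧸ p) ≠ ⊤ := by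
  set m := maximalIdeal R
  have hIm : I ≤ m := le_maximalIdeal hI
  by_cases hIp : I ≤ p
  · rw [grMult_eq_zero_of_pow_smul (T := 1)]
    · simp
    · rw [pow_one, eq_bot_iff, Submodule.smul_le]
      intro r hr x _
      obtain ⟨x, rfl⟩ := Ideal.Quotient.mk_surjective x
      exact Ideal.Quotient.eq_zero_iff_mem.2 (p.mul_mem_right x (hIp hr))
  let A : ℕ → Submodule R (R ⧸ p) := fun n => I ^ n • ⊤
  have hA : IsRees I A := IsRees.pow I
  have hAm : Antitone A := fun i j h => Submodule.smul_mono_left (Ideal.pow_le_pow_right h)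
  obtain ⟨a, haI, hap, n₀, hn₀⟩ := exists_filterRegular hA (hA.shift 1) (Set.finite_singleton p)
    (by rintro _ rfl; exact hIp)
  have hap : a ∉ p := hap p rfl
  have hreg : IsSMulRegular (R ⧸ p) a := by
    refine (isSMulRegular_iff_right_eq_zero_of_smul).2 fun x hx => ?_
    obtain ⟨x, rfl⟩ := Ideal.Quotient.mk_surjective x
    have h1 : Ideal.Quotient.mk p (a * x) = 0 := hx
    rw [Ideal.Quotient.eq_zero_iff_mem] at h1 ⊢
    exact (Ideal.IsPrime.mem_or_mem ‹_› h1).resolve_left hap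
  obtain ⟨n₁, hn₁⟩ := exists_inf_le_map hreg hn₀
  have hdim' : Module.supportDim R (QuotSMulTop a (R ⧸ p)) ≤ (k : WithBot ℕ∞) := by
    have h := Module.supportDim_quotSMulTop_succ_eq_supportDim hreg (hIm haI)
    rw [← h, Nat.cast_add, Nat.cast_one] at hdim
    exact ENat.WithBot.add_le_add_one_right_iff.1 hdim
  have hmapA : ∀ n, (A n).map (LinearMap.lsmul R _ a) ≤ A (n + 1) := hA.map_le haI
  rcases k with _ | k
  -- For `k = 0` the quotient by `a` is killed by some `𝔪 ^ T`. Hence `A (n + 1) ≤ a A n` for large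
  -- `n`, and multiplication by `a` shows that the lengths of `A n / A (n + 1)` are eventually
  -- nonincreasing.
  · obtain ⟨T, hT⟩ := exists_pow_smul_eq_bot (R := R) (by simpa using hdim')
    have hTa : ∀ r ∈ m ^ T, ∃ s, r - a * s ∈ p := by
      intro r hr
      have h1 : r • (Submodule.Quotient.mk (Ideal.Quotient.mk p 1) : QuotSMulTop a (R ⧸ p)) = 0 := by
        have := Submodule.smul_mem_smul hr
          (Submodule.mem_top (x := (Submodule.Quotient.mk (Ideal.Quotient.mk p 1) :
            QuotSMulTop a (R ⧸ p))))
        rwa [hT, Submodule.mem_bot] at this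
      rw [← Submodule.Quotient.mk_smul, Submodule.Quotient.mk_eq_zero] at h1
      obtain ⟨s, -, hs⟩ := h1
      obtain ⟨s, rfl⟩ := Ideal.Quotient.mk_surjective s
      refine ⟨s, ?_⟩
      have h2 : Ideal.Quotient.mk p (a * s) = Ideal.Quotient.mk p (r * 1) := hs
      rw [← Ideal.Quotient.eq, h2, mul_one]
    have hmA : ∀ n, m ^ T • A n ≤ (A n).map (LinearMap.lsmul R _ a) := by
      intro n
      refine Submodule.smul_le.2 fun r hr x hx => ?_
      obtain ⟨s, hs⟩ := hTa r hr
      refine ⟨s • x, (A n).smul_mem s hx, ?_⟩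
      obtain ⟨x, rfl⟩ := Ideal.Quotient.mk_surjective x
      have h2 : Ideal.Quotient.mk p (a * (s * x)) = Ideal.Quotient.mk p (r * x) := by
        rw [eq_comm, Ideal.Quotient.eq, show r * x - a * (s * x) = (r - a * s) * x by ring]
        exact p.mul_mem_right x hs
      exact h2
    have hle : ∀ n ≥ max n₁ T, A (n + 1) ≤ (A n).map (LinearMap.lsmul R _ a) := by
      intro n hn
      refine le_trans (le_inf ?_ le_rfl) (hn₁ n (le_trans (le_max_left _ _) hn))
      have h0 : A (n + 1) ≤ m ^ T • A 0 := by
        have : A 0 = ⊤ := by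
          change I ^ 0 • (⊤ : Submodule R (R ⧸ p)) = ⊤
          rw [pow_zero, Ideal.one_eq_top, Submodule.top_smul]
        rw [this]
        refine Submodule.smul_mono_left ((Ideal.pow_right_mono hIm _).trans ?_)
        exact Ideal.pow_le_pow_right (by have := le_max_right n₁ T; omega)
      refine (h0.trans (hmA 0)).trans ?_
      rintro _ ⟨x, -, rfl⟩
      exact Submodule.smul_mem_pointwise_smul x a ⊤ trivial
    have hbd : ∀ n ≥ max n₁ T, rlen (A n) (A (n + 1)) ≤
        rlen (A (max n₁ T)) (A (max n₁ T + 1)) := by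
      intro n hn
      induction n, hn using Nat.le_induction with
      | base => exact le_rfl
      | succ n hn ihn =>
        refine le_trans ?_ ihn
        refine (rlen_mono_left (hle n hn) _).trans ?_
        rw [rlen_map]
        exact rlen_anti_right _ (Submodule.map_le_iff_le_comap.1 (hmapA (n + 1)))
    refine ne_top_of_le_ne_top (rlen_ne_top_of_pow_smul_le
      ((hmA (max n₁ T)).trans (hmapA (max n₁ T)))) (iSup_le fun i => ?_)
    refine limsup_le_of_le (by isBoundedDefault) ?_
    filter_upwards [eventually_ge_atTop (max n₁ T)] with n hn
    rw [weight_zero, div_one]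
    exact (rlen_anti_right _ (le_trunc m A (fun n => A (n + 1)) i n)).trans (hbd n hn)
  · have hfin := ih k rfl _ hdim'
    refine ne_top_of_le_ne_top hfin ?_
    rw [grMult_eq_of_surjective _ (Submodule.mkQ_surjective (a • (⊤ : Submodule R (R ⧸ p)))),
      Submodule.ker_mkQ]
    refine iSup_le fun i => le_trans ?_ (le_iSup _ i)
    -- Truncation by `𝔪 ^ i` makes all lengths finite. The inequality for differences needs no
    -- regularity; regularity enters when `g` is compared with the graded module of the quotient by
    -- `a`.
    refine limsup_div_weight_le (n₀ := 0)
      (g := fun n => rlen (A n) (m ^ i • A n ⊔ cut A (fun n => A (n + 1)) a n)) ?_ ?_ ?_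
    · exact fun n _ => rlen_ne_top_of_pow_smul_le (i := i) le_sup_left
    · intro n _
      have e : m ^ i • A (n + 1) ⊔ cut A (fun n => A (n + 1)) a (n + 1) =
          (A n).map (LinearMap.lsmul R _ a) ⊔ trunc m A (fun n => A (n + 1)) i (n + 1) := by
        change m ^ i • A (n + 1) ⊔ ((A n).map (LinearMap.lsmul R _ a) ⊔ A (n + 1 + 1)) =
          (A n).map (LinearMap.lsmul R _ a) ⊔ (m ^ i • A (n + 1) ⊔ A (n + 1 + 1))
        rw [sup_left_comm]
      rw [e]
      refine rlen_le_add_of_map_le (trunc_le (fun n => hAm (by omega)) i (n + 1)) (hmapA n) ?_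
      change (m ^ i • A n ⊔ A (n + 1)).map _ ≤ m ^ i • A (n + 1) ⊔ A (n + 1 + 1)
      rw [Submodule.map_sup, Submodule.map_smul'']
      exact sup_le_sup (smul_mono_right _ (hmapA n)) (hmapA (n + 1))
    · refine growth_le_growth ?_
      filter_upwards [eventually_ge_atTop (n₁ + 1)] with n hn
      obtain ⟨n, rfl⟩ : ∃ l, n = l + 1 := ⟨n - 1, by omega⟩
      refine rlen_anti_right _ (sup_le_sup_left ?_ _)
      refine sup_le le_sup_right ((hn₁ n (by omega)).trans le_sup_left)

theorem grMult_ne_top (hI : I ≠ ⊤) (k : ℕ) (M : Type v) [AddCommGroup M] [Module R M]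
    [Module.Finite R M] (hdim : Module.supportDim R M ≤ ((k + 1 : ℕ) : WithBot ℕ∞)) :
    grMult (maximalIdeal R) k I M ≠ ⊤ := by
  have devissage : ∀ k, (∀ p : PrimeSpectrum R,
      Module.supportDim R (R ⧸ p.asIdeal) ≤ ((k + 1 : ℕ) : WithBot ℕ∞) →
        grMult (maximalIdeal R) k I (R ⧸ p.asIdeal) ≠ ⊤) →
      ∀ (N : Type (max u v)) [AddCommGroup N] [Module R N] [Module.Finite R N],
        Module.supportDim R N ≤ ((k + 1 : ℕ) : WithBot ℕ∞) →
          grMult (maximalIdeal R) k I N ≠ ⊤ := by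
    intro k hp N _ _ hN
    induction hN using IsNoetherianRing.induction_on_isQuotientEquivQuotientPrime R with
    | subsingleton N =>
      intro _
      rw [grMult_eq_zero_of_pow_smul (T := 0) (Subsingleton.elim _ _)]
      simp
    | quotient N p e =>
      intro h
      rw [Module.supportDim_eq_of_equiv e] at h
      rw [grMult_congr e]
      exact hp p h
    | exact N₁ N₂ N₃ f g hf hg hfg h₁ h₃ =>
      intro h
      rw [grMult_add_of_exact (maximalIdeal R) k I f g hf hg hfg]
      exact ENNReal.add_ne_top.2 ⟨h₁ ((Module.supportDim_le_of_injective f hf).trans h),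
        h₃ ((Module.supportDim_le_of_surjective g hg).trans h)⟩
  -- The universe `max u v` accommodates both `M` and the quotients of `R` that occur in the
  -- induction on `k`.
  have main : ∀ k (N : Type (max u v)) [AddCommGroup N] [Module R N] [Module.Finite R N],
      Module.supportDim R N ≤ ((k + 1 : ℕ) : WithBot ℕ∞) →
        grMult (maximalIdeal R) k I N ≠ ⊤ := by
    intro k
    induction k with
    | zero =>
      exact devissage 0 fun p hp =>
        grMult_quotient_prime_ne_top hI hp fun l hl => absurd hl (by omega)
    | succ k ih =>
      refine devissage (k + 1) fun p hp => grMult_quotient_prime_ne_top hI hp ?_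
      rintro l hl N _ _ _ hN
      obtain rfl : l = k := by omega
      let e : N ≃ₗ[R] ULift.{v} N := ULift.moduleEquiv.symm
      have := Module.Finite.equiv e
      rw [grMult_congr e]
      exact ih (ULift.{v} N) (by rwa [← Module.supportDim_eq_of_equiv e])
  let e : M ≃ₗ[R] ULift.{u} M := ULift.moduleEquiv.symm
  have := Module.Finite.equiv e
  rw [grMult_congr e]
  exact main k (ULift.{u} M) (by rwa [← Module.supportDim_eq_of_equiv e])

theorem grMult_eq_zero (hI : I ≠ ⊤) (k : ℕ) (M : Type v) [AddCommGroup M] [Module R M]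
    [Module.Finite R M] (hdim : Module.supportDim R M ≤ (k : WithBot ℕ∞)) :
    grMult (maximalIdeal R) k I M = 0 := by
  rcases k with _ | k
  · obtain ⟨T, hT⟩ := exists_pow_smul_eq_bot (R := R) (M := M) (by simpa using hdim)
    refine grMult_eq_zero_of_pow_smul (T := T) (le_bot_iff.1 ?_)
    rw [← hT]
    exact Submodule.smul_mono_left (Ideal.pow_right_mono (le_maximalIdeal hI) T)
  · exact grMult_succ_eq_zero (grMult_ne_top hI k M hdim)

end Finiteness

/-! ### From multiplicities to the normalized lengths -/

section Limit

open IsLocalRing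

theorem tendsto_factorial_div_pow_mul_choose (k : ℕ) :
    Tendsto (fun n : ℕ => (k.factorial : ℝ) / (n : ℝ) ^ k * ((n + k).choose k : ℕ))
      atTop (𝓝 1) := by
  induction k with
  | zero => simp
  | succ k ih =>
    have h1 : Tendsto (fun n : ℕ => (1 : ℝ) + ((k + 1 : ℕ) : ℝ) / (n : ℝ)) atTop (𝓝 1) := by
      simpa using (tendsto_const_div_atTop_nhds_zero_nat ((k + 1 : ℕ) : ℝ)).const_add (1 : ℝ)
    have h2 := ih.mul h1
    rw [mul_one] at h2
    refine h2.congr' ?_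
    filter_upwards [eventually_gt_atTop 0] with n hn
    have hn' : (n : ℝ) ≠ 0 := by exact_mod_cast hn.ne'
    have h3 : (((n + k + 1).choose (k + 1) : ℕ) : ℝ) * (k + 1) =
        ((n + k).choose k : ℕ) * (n + k + 1) := by
      have := Nat.add_one_mul_choose_eq (n + k) k
      rw [mul_comm] at this
      exact_mod_cast this.symm
    rw [← add_assoc, Nat.factorial_succ, pow_succ]
    push_cast
    field_simp
    linear_combination -h3

variable {R : Type u} [CommRing R] [IsNoetherianRing R] [IsLocalRing R]
  [Infinite (ResidueField R)] {I : Ideal R} {M : Type v} [AddCommGroup M] [Module R M]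
  [Module.Finite R M]

theorem tendsto_grLength_div_weight {k : ℕ} (h : grMult (maximalIdeal R) k I M ≠ ⊤) :
    Tendsto (fun n => (grLength I M n : ℝ≥0∞) / weight k n) atTop
      (𝓝 (grMult (maximalIdeal R) k I M)) := by
  have hA := IsRees.pow (M := M) I
  have hle : (fun n => I ^ (n + 1) • (⊤ : Submodule R M)) ≤ fun n => I ^ n • ⊤ :=
    fun n => Submodule.smul_mono_left (Ideal.pow_le_pow_right (by omega))
  -- `K n / I ^ (n + 1) M` is exactly `H⁰_𝔪(I ^ n M / I ^ (n + 1) M)`. The uniform exponent `T`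
  -- makes its length finite, so `toNat` loses nothing.
  obtain ⟨K, hK, hBK, hmem, ⟨T, hT⟩, hgr⟩ := exists_torsion hA (hA.shift 1) hle h
  have h1 := tendsto_growth hK (hA.shift 1) hBK k
  rw [hgr] at h1
  refine h1.congr fun n => ?_
  congr 1
  have hKA : K n ≤ I ^ n • ⊤ := fun x hx => ((hmem n x).1 hx).1
  let f₀ : K n →ₗ[R] GrPiece I M n := Submodule.mkQ _ ∘ₗ Submodule.inclusion hKA
  have hf₀ : ∀ x : K n, f₀ x ∈ (maximalIdeal R).primaryComponent (GrPiece I M n) := by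
    intro x
    obtain ⟨T, hT⟩ := ((hmem n x).1 x.2).2
    rw [Ideal.primaryComponent_mem]
    refine ⟨T, (Submodule.mem_torsionBySet_iff _ _).2 fun r => ?_⟩
    change (r : R) • f₀ x = 0
    rw [← map_smul]
    exact (Submodule.Quotient.mk_eq_zero _).2 (hT r r.2)
  let f := f₀.codRestrict _ hf₀
  have hf : Function.Surjective f := by
    rintro ⟨y, hy⟩
    obtain ⟨x, rfl⟩ := Submodule.Quotient.mk_surjective _ y
    rw [Ideal.primaryComponent_mem] at hy
    obtain ⟨T, hT⟩ := hy
    have hx : (x : M) ∈ K n := by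
      refine (hmem n x).2 ⟨x.2, T, fun r hr => ?_⟩
      have h2 := (Submodule.mem_torsionBySet_iff _ _).1 hT ⟨r, hr⟩
      change r • Submodule.Quotient.mk x = 0 at h2
      rw [← Submodule.Quotient.mk_smul, Submodule.Quotient.mk_eq_zero] at h2
      exact h2
    exact ⟨⟨x, hx⟩, rfl⟩
  have hlen := rlen_eq_of_surjective (A := K n) (B := I ^ (n + 1) • ⊤) f hf fun a => by
    rw [← Subtype.coe_inj]
    exact Submodule.Quotient.mk_eq_zero _
  have hfin := rlen_ne_top_of_pow_smul_le (hT n)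
  rw [hlen] at hfin ⊢
  rw [grLength]
  have : Module.length R ((maximalIdeal R).primaryComponent (GrPiece I M n)) ≠ ⊤ := by
    simpa using hfin
  conv_lhs => rw [← ENat.natCast_toNat this]
  simp

theorem tendsto_jSeq {k : ℕ} (h : grMult (maximalIdeal R) k I M ≠ ⊤) :
    Tendsto (jSeq (k + 1) I M) atTop (𝓝 (grMult (maximalIdeal R) k I M).toReal) := by
  have h1 := (ENNReal.tendsto_toReal h).comp (tendsto_grLength_div_weight h)
  have h2 := h1.mul (tendsto_factorial_div_pow_mul_choose k)
  rw [mul_one] at h2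
  refine h2.congr fun n => ?_
  have h3 : (((n + k).choose k : ℕ) : ℝ) ≠ 0 := by
    have : 0 < (n + k).choose k := Nat.choose_pos (by omega)
    exact_mod_cast this.ne'
  simp only [Function.comp, weight, ENNReal.toReal_div, ENNReal.toReal_natCast, jSeq,
    Nat.add_sub_cancel]
  field_simp

theorem jMult_eq {k : ℕ} (h : grMult (maximalIdeal R) k I M ≠ ⊤) :
    jMult (k + 1) I M = (grMult (maximalIdeal R) k I M).toReal :=
  (tendsto_jSeq h).limUnder_eq

end Limit

/-! ### Lengths of localizations -/

section LocalLength

variable {R : Type u} [CommRing R]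

theorem length_localizedModule_eq_add (p : PrimeSpectrum R) {L : Type v} {M : Type v} {N : Type v}
    [AddCommGroup L] [Module R L] [AddCommGroup M] [Module R M] [AddCommGroup N] [Module R N]
    (f : L →ₗ[R] M) (g : M →ₗ[R] N) (hf : Function.Injective f) (hg : Function.Surjective g)
    (hfg : Function.Exact f g) :
    Module.length (Localization.AtPrime p.asIdeal) (LocalizedModule p.asIdeal.primeCompl M) =
      Module.length (Localization.AtPrime p.asIdeal) (LocalizedModule p.asIdeal.primeCompl L) +
      Module.length (Localization.AtPrime p.asIdeal) (LocalizedModule p.asIdeal.primeCompl N) :=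
  Module.length_eq_add_of_exact (LocalizedModule.map p.asIdeal.primeCompl f)
    (LocalizedModule.map p.asIdeal.primeCompl g)
    (LocalizedModule.map_injective p.asIdeal.primeCompl f hf)
    (LocalizedModule.map_surjective p.asIdeal.primeCompl g hg)
    (LocalizedModule.map_exact p.asIdeal.primeCompl f g hfg)

theorem length_localizedModule_congr (p : PrimeSpectrum R) {M : Type v} {N : Type w}
    [AddCommGroup M] [Module R M] [AddCommGroup N] [Module R N] (e : M ≃ₗ[R] N) :
    Module.length (Localization.AtPrime p.asIdeal) (LocalizedModule p.asIdeal.primeCompl M) =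
      Module.length (Localization.AtPrime p.asIdeal) (LocalizedModule p.asIdeal.primeCompl N) :=
  le_antisymm
    (Module.length_le_of_injective (LocalizedModule.map p.asIdeal.primeCompl e.toLinearMap)
      (LocalizedModule.map_injective _ _ e.injective))
    (Module.length_le_of_surjective (LocalizedModule.map p.asIdeal.primeCompl e.toLinearMap)
      (LocalizedModule.map_surjective _ _ e.surjective))

/-- The localization is nonzero and cyclic, with a generator killed by the maximal ideal, so it is
the residue field at `p`. -/
theorem length_localizedModule_quotient_self (p : PrimeSpectrum R) :
    Module.length (Localization.AtPrime p.asIdeal)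
      (LocalizedModule p.asIdeal.primeCompl (R ⧸ p.asIdeal)) = 1 := by
  let S := p.asIdeal.primeCompl
  let X := LocalizedModule S (R ⧸ p.asIdeal)
  let x₀ : X := LocalizedModule.mk 1 1
  let f : Localization.AtPrime p.asIdeal →ₗ[Localization.AtPrime p.asIdeal] X :=
    LinearMap.toSpanSingleton _ X x₀
  have hf : Function.Surjective f := by
    intro y
    induction y using LocalizedModule.induction_on with
    | h r s =>
      obtain ⟨r, rfl⟩ := Ideal.Quotient.mk_surjective r
      refine ⟨Localization.mk r s, ?_⟩
      change Localization.mk r s • (LocalizedModule.mk 1 1 : X) = _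
      rw [LocalizedModule.mk_smul_mk, mul_one]
      congr 1
      exact congrArg (Ideal.Quotient.mk p.asIdeal) (mul_one r)
  have hnt : Nontrivial X := by
    refine Module.mem_support_iff.1 ?_
    rw [Module.support_eq_zeroLocus, Ideal.annihilator_quotient]
    exact fun _ h => h
  have hle : IsLocalRing.maximalIdeal (Localization.AtPrime p.asIdeal) ≤ LinearMap.ker f := by
    rw [← Localization.AtPrime.map_eq_maximalIdeal, Ideal.map_le_iff_le_comap]
    intro r hr
    change algebraMap R (Localization.AtPrime p.asIdeal) r • x₀ = 0
    rw [algebraMap_smul]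
    change r • (LocalizedModule.mk 1 1 : X) = 0
    rw [LocalizedModule.smul'_mk]
    have : r • (1 : R ⧸ p.asIdeal) = 0 :=
      (Ideal.Quotient.eq_zero_iff_mem (a := r * 1)).2 (by rwa [mul_one])
    rw [this, LocalizedModule.zero_mk]
  have hker : LinearMap.ker f = IsLocalRing.maximalIdeal (Localization.AtPrime p.asIdeal) := by
    refine ((IsLocalRing.maximalIdeal.isMaximal _).eq_of_le (fun htop => ?_) hle).symm
    obtain ⟨y, hy⟩ := exists_ne (0 : X)
    obtain ⟨a, rfl⟩ := hf y
    exact hy (LinearMap.mem_ker.1 (htop ▸ Submodule.mem_top))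
  rw [← (f.quotKerEquivOfSurjective hf).length_eq, hker]
  have : IsSimpleModule (Localization.AtPrime p.asIdeal) (Localization.AtPrime p.asIdeal ⧸
      IsLocalRing.maximalIdeal (Localization.AtPrime p.asIdeal)) :=
    isSimpleModule_iff_isCoatom.2 (IsLocalRing.maximalIdeal.isMaximal _).out
  exact Module.length_eq_one _ _

end LocalLength

/-! ### The associativity formula -/

section Formula

open IsLocalRing

variable {R : Type u} [CommRing R]

theorem ringKrullDim_quotient_add_one_le {q p : PrimeSpectrum R} (h : q < p) :
    ringKrullDim (R ⧸ p.asIdeal) + 1 ≤ ringKrullDim (R ⧸ q.asIdeal) := by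
  have hle : q.asIdeal ≤ p.asIdeal := h.le
  obtain ⟨x, hxp, hxq⟩ := Set.exists_of_ssubset (show (q.asIdeal : Set R) ⊂ p.asIdeal from h)
  refine ringKrullDim_succ_le_of_surjective (Ideal.Quotient.factor hle)
    (Ideal.Quotient.factor_surjective hle) (r := Ideal.Quotient.mk q.asIdeal x) ?_ ?_
  · rw [mem_nonZeroDivisors_iff_ne_zero, Ne, Ideal.Quotient.eq_zero_iff_mem]
    exact hxq
  · rw [Ideal.Quotient.factor_mk, Ideal.Quotient.eq_zero_iff_mem]
    exact hxp

theorem eq_of_le_of_ringKrullDim_le {q p : PrimeSpectrum R} (h : q ≤ p) {d : ℕ}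
    (hq : ringKrullDim (R ⧸ q.asIdeal) ≤ (d : WithBot ℕ∞))
    (hp : ringKrullDim (R ⧸ p.asIdeal) = (d : WithBot ℕ∞)) : q = p := by
  by_contra hne
  have h1 := (ringKrullDim_quotient_add_one_le (lt_of_le_of_ne h hne)).trans hq
  rw [hp] at h1
  have h2 : d + 1 ≤ d := by exact_mod_cast h1
  omega

theorem mem_support_quotient_iff {q p : PrimeSpectrum R} :
    p ∈ Module.support R (R ⧸ q.asIdeal) ↔ q ≤ p := by
  rw [Module.support_eq_zeroLocus, Ideal.annihilator_quotient]
  rfl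

theorem length_localizedModule_eq_zero {M : Type v} [AddCommGroup M] [Module R M]
    {p : PrimeSpectrum R} (h : p ∉ Module.support R M) :
    Module.length (Localization.AtPrime p.asIdeal) (LocalizedModule p.asIdeal.primeCompl M) = 0 := by
  have := Module.notMem_support_iff.1 h
  exact Module.length_eq_zero

theorem toReal_toENNReal (l : ℕ∞) : (l : ℝ≥0∞).toReal = (l.toNat : ℝ) := by
  induction l using ENat.recTopCoe <;> simp

variable [IsNoetherianRing R]

/-- A prime of maximal dimension in the support is minimal over the annihilator, since a strictly
smaller prime would have larger dimension. -/
theorem mem_associatedPrimes_of_ringKrullDim_eq {M : Type v} [AddCommGroup M] [Module R M]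
    [Module.Finite R M] {p : PrimeSpectrum R} (hp : p ∈ Module.support R M) {d : ℕ}
    (hM : Module.supportDim R M ≤ (d : WithBot ℕ∞))
    (hd : ringKrullDim (R ⧸ p.asIdeal) = (d : WithBot ℕ∞)) :
    p.asIdeal ∈ associatedPrimes R M := by
  refine Module.associatedPrimes.minimalPrimes_annihilator_subset_associatedPrimes R M
    ⟨⟨p.2, Module.mem_support_iff_of_finite.1 hp⟩, fun q hq hqp => ?_⟩
  have h : ringKrullDim (R ⧸ q) ≤ (d : WithBot ℕ∞) := by
    refine le_trans ?_ hM
    rw [Module.supportDim_eq_ringKrullDim_quotient_annihilator]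
    exact ringKrullDim_le_of_surjective (Ideal.Quotient.factor hq.2)
      (Ideal.Quotient.factor_surjective hq.2)
  exact (congrArg PrimeSpectrum.asIdeal
    (eq_of_le_of_ringKrullDim_le (q := ⟨q, hq.1⟩) (p := p) hqp h hd)).ge

variable [IsLocalRing R] [Infinite (ResidueField R)] {I : Ideal R}

/-- The index set `F` is any finite set of primes of dimension `k + 1` containing all those in the
support. Unlike `assh`, it can stay fixed along an exact sequence, so both sides are additive. -/
theorem grMult_eq_sum (hI : I ≠ ⊤) (k : ℕ) (M : Type v) [AddCommGroup M] [Module R M]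
    [Module.Finite R M] (hM : Module.supportDim R M ≤ ((k + 1 : ℕ) : WithBot ℕ∞))
    (F : Finset (PrimeSpectrum R))
    (hF : ∀ p ∈ F, ringKrullDim (R ⧸ p.asIdeal) = ((k + 1 : ℕ) : WithBot ℕ∞))
    (hMF : ∀ p ∈ Module.support R M,
      ringKrullDim (R ⧸ p.asIdeal) = ((k + 1 : ℕ) : WithBot ℕ∞) → p ∈ F) :
    grMult (maximalIdeal R) k I M = ∑ p ∈ F,
      (Module.length (Localization.AtPrime p.asIdeal)
        (LocalizedModule p.asIdeal.primeCompl M) : ℝ≥0∞) *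
        grMult (maximalIdeal R) k I (R ⧸ p.asIdeal) := by
  induction ‹Module.Finite R M› using
    IsNoetherianRing.induction_on_isQuotientEquivQuotientPrime R with
  | subsingleton N =>
    rw [grMult_eq_zero_of_pow_smul (T := 0) (Subsingleton.elim _ _), eq_comm]
    refine Finset.sum_eq_zero fun p _ => ?_
    rw [length_localizedModule_eq_zero (by simp [Module.support_eq_empty])]
    simp
  | quotient N q e =>
    rw [grMult_congr e]
    rw [Module.supportDim_eq_of_equiv e, Module.supportDim_quotient_eq_ringKrullDim] at hM
    have hzero : ∀ p ∈ F, p ≠ q → (Module.length (Localization.AtPrime p.asIdeal)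
        (LocalizedModule p.asIdeal.primeCompl N) : ℝ≥0∞) *
        grMult (maximalIdeal R) k I (R ⧸ p.asIdeal) = 0 := by
      intro p hp hpq
      rw [length_localizedModule_congr p e, length_localizedModule_eq_zero]
      · simp
      · rw [mem_support_quotient_iff]
        exact fun hle => hpq (eq_of_le_of_ringKrullDim_le hle hM (hF p hp)).symm
    by_cases hq : ringKrullDim (R ⧸ q.asIdeal) = ((k + 1 : ℕ) : WithBot ℕ∞)
    · have hqF : q ∈ F := by
        refine hMF q ?_ hq
        rw [e.support_eq, mem_support_quotient_iff]
      rw [Finset.sum_eq_single q hzero fun h => absurd hqF h, length_localizedModule_congr q e,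
        length_localizedModule_quotient_self]
      simp
    · rw [Finset.sum_eq_zero fun p hp => hzero p hp (by rintro rfl; exact hq (hF p hp))]
      refine grMult_eq_zero hI k _ ?_
      rw [Module.supportDim_quotient_eq_ringKrullDim]
      have h1 := lt_of_le_of_ne hM hq
      rw [Nat.cast_add, Nat.cast_one] at h1
      exact ENat.WithBot.lt_add_one_iff.1 h1
  | exact N₁ N₂ N₃ f g hf hg hfg h₁ h₃ =>
    rw [grMult_add_of_exact (maximalIdeal R) k I f g hf hg hfg,
      h₁ ((Module.supportDim_le_of_injective f hf).trans hM) fun p hp =>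
        hMF p (Module.support_subset_of_injective f hf hp),
      h₃ ((Module.supportDim_le_of_surjective g hg).trans hM) fun p hp =>
        hMF p (Module.support_subset_of_surjective g hg hp), ← Finset.sum_add_distrib]
    refine Finset.sum_congr rfl fun p _ => ?_
    rw [length_localizedModule_eq_add p f g hf hg hfg, ENat.toENNReal_add, add_mul]

theorem grMult_eq_sum_assh (hI : I ≠ ⊤) (k : ℕ) (M : Type v) [AddCommGroup M] [Module R M]
    [Module.Finite R M] (hM : Module.supportDim R M ≤ ((k + 1 : ℕ) : WithBot ℕ∞)) :
    grMult (maximalIdeal R) k I M = ∑ p ∈ (assh_finite R M).toFinset,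
      (Module.length (Localization.AtPrime p.asIdeal)
        (LocalizedModule p.asIdeal.primeCompl M) : ℝ≥0∞) *
        grMult (maximalIdeal R) k I (R ⧸ p.asIdeal) := by
  by_cases hd : Module.supportDim R M = ((k + 1 : ℕ) : WithBot ℕ∞)
  · refine grMult_eq_sum hI k M hM _ (fun p hp => ?_) fun p hp hpd => ?_
    · rw [Set.Finite.mem_toFinset] at hp
      exact hp.2.trans hd
    · rw [Set.Finite.mem_toFinset]
      exact ⟨mem_associatedPrimes_of_ringKrullDim_eq hp hM hpd, hpd.trans hd.symm⟩
  -- When `dim M < k + 1`, every prime in `assh` also has dimension at most `k`, and both sides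
  -- vanish.
  · have h1 := lt_of_le_of_ne hM hd
    rw [Nat.cast_add, Nat.cast_one] at h1
    have h2 := ENat.WithBot.lt_add_one_iff.1 h1
    rw [grMult_eq_zero hI k M h2, Finset.sum_eq_zero]
    intro p hp
    rw [Set.Finite.mem_toFinset] at hp
    rw [grMult_eq_zero hI k (R ⧸ p.asIdeal)
      (by rw [Module.supportDim_quotient_eq_ringKrullDim, hp.2]; exact h2), mul_zero]

end Formula

end JMult
end

theorem theorem3p9 {R : Type*} [CommRing R] [IsLocalRing R] [IsNoetherianRing R]
    [Infinite (IsLocalRing.ResidueField R)] (hR : 0 < ringKrullDim R)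
    (I : Ideal R) (hI : I ≠ ⊤)
    (M : Type*) [AddCommGroup M] [Module R M] [Module.Finite R M]
    (d : ℕ) (hd : 0 < d) (hM : Module.supportDim R M ≤ (d : WithBot ℕ∞)) :
    Tendsto (JMult.jSeq d I M) atTop (𝓝 (JMult.jMult d I M)) ∧
    (∀ p ∈ JMult.assh R M,
      Tendsto (JMult.jSeq d I (R ⧸ p.asIdeal)) atTop (𝓝 (JMult.jMult d I (R ⧸ p.asIdeal)))) ∧
    JMult.jMult d I M =
      ∑ p ∈ (JMult.assh_finite R M).toFinset,
        (JMult.localLength M p : ℝ) * JMult.jMult d I (R ⧸ p.asIdeal) := by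
  obtain ⟨k, rfl⟩ : ∃ k, d = k + 1 := ⟨d - 1, by omega⟩
  have h1 := JMult.grMult_ne_top hI k M hM
  have h2 : ∀ p ∈ JMult.assh R M,
      JMult.grMult (IsLocalRing.maximalIdeal R) k I (R ⧸ p.asIdeal) ≠ ⊤ := fun p hp =>
    JMult.grMult_ne_top hI k _
      (by rw [Module.supportDim_quotient_eq_ringKrullDim, hp.2]; exact hM)
  refine ⟨?_, fun p hp => ?_, ?_⟩
  · rw [JMult.jMult_eq h1]
    exact JMult.tendsto_jSeq h1
  · rw [JMult.jMult_eq (h2 p hp)]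
    exact JMult.tendsto_jSeq (h2 p hp)
  · have h3 := JMult.grMult_eq_sum_assh hI k M hM
    -- The sum equals a finite quantity, so each summand is finite and `toReal` passes through the
    -- sum.
    rw [JMult.jMult_eq h1, h3, ENNReal.toReal_sum (ENNReal.sum_ne_top.1 (h3 ▸ h1))]
    refine Finset.sum_congr rfl fun p hp => ?_
    rw [Set.Finite.mem_toFinset] at hp
    rw [ENNReal.toReal_mul, JMult.jMult_eq (h2 p hp), JMult.localLength]
    congr 1
    exact JMult.toReal_toENNReal _
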